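/- Let $n$ be a natural number and let $f$ be a quadro-quadric Cremona transformation of $\mathbb P^{n-1}$ over $\mathbb C$, that is, a birational map such that $f$ and $g=f^{-1}$ are both of degree $2$. Let $F=(f_1,\dots,f_n)$ and $G=(g_1,\dots,g_n)$, maps from $\mathbb C^n$ to $\mathbb C^n$, be quadratic lifts of $f$ and $g$: the $f_i$ are quadratic forms without common factor with $f([x])=[F(x)]$, and similarly for $G$ and $g$. Then there is exactly one cubic form $N$ on $\mathbb C^n$ with $G(F(x))=N(x)\,x$ for all $x\in\mathbb C^n$. Let $X_f$ be the Zariski closure of the image of $$\mu_f:\mathbb C^n\to\mathbb P(\mathbb C\oplus\mathbb C^n\oplus\mathbb C^n\oplus\mathbb C)=\mathbb P^{2n+1},\qquad x\mapsto[1:x:F(x):N(x)].$$ Then $X_f$ is an irreducible projective variety of dimension $n$ which belongs to the class $\boldsymbol X^n(3,3)$, that is: 1. $X_f$ is non-degenerate: its linear span is $\mathbb P^{2n+1}$; 2. $X_f$ is 3-rationally connected (3-covered) by twisted cubics: there is a nonempty Zariski open subset $U$ of $X_f\times X_f\times X_f$ such that for every $(p_1,p_2,p_3)\in U$ there is a twisted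 cubic contained in $X_f$ that passes through $p_1,p_2,p_3$ (a twisted cubic is a curve of the form $\{[s^3c_0+s^2t\,c_1+st^2c_2+t^3c_3] : [s:t]\in\mathbb P^1\}$ with $c_0,\dots,c_3$ linearly independent); 3. $X_f$ is not a rational normal scroll: it is not projectively equivalent to any $n$-dimensional rational normal scroll $S_{a_1\dots a_n}$, where the integers $a_i\ge 0$ are not all zero (in particular not to $S_{1\dots 13}$ or $S_{1\dots 122}$). -/

import Mathlib

open scoped LinearAlgebra.Projectivization

noncomputable section

/-! ## Projective spaces over `ℂ` and their Zariski topology -/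

/-- The complex projective space with homogeneous coordinates indexed by `σ`
(of dimension `card σ - 1`). -/
abbrev ProjSpace (σ : Type) : Type := ℙ ℂ (σ → ℂ)

/-- The polynomial `P` vanishes at the chosen representative of `p`. It is used for homogeneous `P`
only, where the representative does not matter. -/
def VanishesAt {σ : Type} (P : MvPolynomial σ ℂ) (p : ProjSpace σ) : Prop :=
  MvPolynomial.eval p.rep P = 0

/-- `Z` is the set of common zeros of a family of homogeneous polynomials. -/
def IsProjAlgebraicSet {σ : Type} (Z : Set (ProjSpace σ)) : Prop :=
  ∃ S : Set (MvPolynomial σ ℂ), (∀ P ∈ S, ∃ d : ℕ, P.IsHomogeneous d) ∧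
    Z = {p | ∀ P ∈ S, VanishesAt P p}

/-- The Zariski topology: the closed sets are the projective algebraic sets. All topological
notions for subsets of a projective space (closure, irreducibility, dimension) refer to it. -/
instance zariskiTopology (σ : Type) : TopologicalSpace (ProjSpace σ) :=
  TopologicalSpace.ofClosed {Z | IsProjAlgebraicSet Z}
    ⟨{1}, by
      rintro P rfl
      exact ⟨0, MvPolynomial.isHomogeneous_one σ ℂ⟩, by
      ext p
      simp [VanishesAt]⟩
    (by
      intro A hA
      refine ⟨{P | (∃ d : ℕ, P.IsHomogeneous d) ∧ ∃ Z ∈ A, ∀ p ∈ Z, VanishesAt P p},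
        fun P hP => hP.1, ?_⟩
      ext p
      simp only [Set.mem_sInter, Set.mem_ofPred_eq]
      constructor
      · rintro h P ⟨-, Z, hZ, hPZ⟩
        exact hPZ p (h Z hZ)
      · intro h Z hZ
        obtain ⟨S, hS, rfl⟩ := hA hZ
        exact fun P hP => h P ⟨hS P hP, _, hZ, fun q hq => hq P hP⟩)
    (by
      rintro _ ⟨S, hS, rfl⟩ _ ⟨T, hT, rfl⟩
      refine ⟨{R | ∃ P ∈ S, ∃ Q ∈ T, R = P * Q}, ?_, ?_⟩
      · rintro _ ⟨P, hP, Q, hQ, rfl⟩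
        obtain ⟨d, hd⟩ := hS P hP
        obtain ⟨e, he⟩ := hT Q hQ
        exact ⟨d + e, hd.mul he⟩
      · ext p
        simp only [Set.mem_union, Set.mem_ofPred_eq]
        constructor
        · rintro (h | h) _ ⟨P, hP, Q, hQ, rfl⟩
          · simp [VanishesAt, show MvPolynomial.eval p.rep P = 0 from h P hP]
          · simp [VanishesAt, show MvPolynomial.eval p.rep Q = 0 from h Q hQ]
        · intro h
          by_contra! hcon
          obtain ⟨⟨P, hP, hP0⟩, Q, hQ, hQ0⟩ := hcon
          have := h _ ⟨P, hP, Q, hQ, rfl⟩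
          rw [VanishesAt, map_mul] at this
          exact (mul_eq_zero.mp this).elim hP0 hQ0)

/-- The projective equivalence of a subset of one projective space with a subset of another one:
an isomorphism of the ambient projective spaces maps the first set onto the second one. -/
def ProjEquivalent {σ τ : Type} (X : Set (ProjSpace σ)) (Y : Set (ProjSpace τ)) : Prop :=
  ∃ e : (σ → ℂ) ≃ₗ[ℂ] (τ → ℂ), Projectivization.map e.toLinearMap e.injective '' X = Y

/-! ## Twisted cubics, 3-rational connectedness, rational normal scrolls -/

/-- A twisted cubic: the image of `ℙ¹` under
`[s : t] ↦ [s³ c₀ + s² t c₁ + s t² c₂ + t³ c₃]` with `c₀, c₁, c₂, c₃` linearly independent. -/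
def IsTwistedCubic {σ : Type} (C : Set (ProjSpace σ)) : Prop :=
  ∃ c : Fin 4 → σ → ℂ, LinearIndependent ℂ c ∧
    C = {p | ∃ s t : ℂ, (s, t) ≠ 0 ∧ ∃ h : (∑ k : Fin 4, (s ^ (3 - (k : ℕ)) * t ^ (k : ℕ)) • c k) ≠ 0,
      p = Projectivization.mk ℂ _ h}

/-- `P`, a polynomial in three groups of variables, is homogeneous in each of them. -/
def IsTriHomogeneous {σ : Type} (P : MvPolynomial (Fin 3 × σ) ℂ) : Prop :=
  ∀ k : Fin 3, ∃ d : ℕ, P.IsWeightedHomogeneous (fun v => if v.1 = k then 1 else 0) d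

/-- The property `R` holds for the general triple of points of the irreducible set `X`, that is, on
a nonempty Zariski open subset of `X × X × X`. The basic open subsets of
a product of three projective spaces are the sets where a tri-homogeneous polynomial does not
vanish. -/
def HoldsForGeneralTriple {σ : Type} (X : Set (ProjSpace σ))
    (R : (Fin 3 → ProjSpace σ) → Prop) : Prop :=
  ∃ P : MvPolynomial (Fin 3 × σ) ℂ, IsTriHomogeneous P ∧
    (∃ p : Fin 3 → ProjSpace σ, (∀ k, p k ∈ X) ∧
      MvPolynomial.eval (fun v => (p v.1).rep v.2) P ≠ 0) ∧
    ∀ p : Fin 3 → ProjSpace σ, (∀ k, p k ∈ X) →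
      MvPolynomial.eval (fun v => (p v.1).rep v.2) P ≠ 0 → R p

/-- `X` is 3-rationally connected (3-covered) by twisted cubics: through three general points of `X`
there passes a twisted cubic contained in `X`. -/
def IsThreeRCByTwistedCubics {σ : Type} (X : Set (ProjSpace σ)) : Prop :=
  HoldsForGeneralTriple X fun p => ∃ C : Set (ProjSpace σ), IsTwistedCubic C ∧ C ⊆ X ∧ ∀ k, p k ∈ C

/-- The standard rational normal scroll `S_{a₁ … aₙ}` in the projective space of dimension
`∑ (aᵢ + 1) - 1`: the union over `[s : t] ∈ ℙ¹` of the linear spaces spanned by the points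
`[s^aᵢ : s^(aᵢ - 1) t : ⋯ : t^aᵢ]` of the `n` rational normal curves of degree `aᵢ` (a point if
`aᵢ = 0`) in complementary linear spaces. -/
def standardScroll {n : ℕ} (a : Fin n → ℕ) : Set (ProjSpace (Σ i : Fin n, Fin (a i + 1))) :=
  {p | ∃ s t : ℂ, (s, t) ≠ 0 ∧ ∃ l : Fin n → ℂ,
    ∀ (i : Fin n) (j : Fin (a i + 1)), p.rep ⟨i, j⟩ = l i * (s ^ (a i - (j : ℕ)) * t ^ (j : ℕ))}

/-- `X` is a rational normal scroll of dimension `n`. Cones (some `aᵢ = 0`) are included. -/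
def IsRationalNormalScroll {σ : Type} (n : ℕ) (X : Set (ProjSpace σ)) : Prop :=
  ∃ a : Fin n → ℕ, (∃ i, 0 < a i) ∧ ProjEquivalent (standardScroll a) X

/-- The class `𝑿ⁿ(3,3)`: irreducible projective varieties of dimension `n` in `ℙ²ⁿ⁺¹` which are
non-degenerate, 3-rationally connected by twisted cubics and not a rational normal scroll. -/
structure IsExtremalX33 {σ : Type} [Fintype σ] (n : ℕ) (X : Set (ProjSpace σ)) : Prop where
  ambient : Fintype.card σ = (2 * n + 1) + 1
  closed : IsClosed X
  irreducible : IsIrreducible X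
  dimension : topologicalKrullDim X = n
  nondegenerate : Projectivization.Subspace.span X = ⊤
  threeRC : IsThreeRCByTwistedCubics X
  not_scroll : ¬ IsRationalNormalScroll n X

/-! ## Quadro-quadric Cremona transformations of `ℙⁿ⁻¹` -/

/-- `F = (f₁, …, fₙ)` is the lift of a rational map of degree `d` from `ℙⁿ⁻¹` to itself: the `fᵢ` are
homogeneous of degree `d` and without common factor. -/
structure IsLiftOfDegree {n : ℕ} (d : ℕ) (F : Fin n → MvPolynomial (Fin n) ℂ) : Prop where
  homogeneous : ∀ i, (F i).IsHomogeneous d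
  coprime : ∀ p : MvPolynomial (Fin n) ℂ, (∀ i, p ∣ F i) → IsUnit p

/-- The polynomial map `ℂⁿ → ℂⁿ` with components `F`. -/
def polyMap {n : ℕ} (F : Fin n → MvPolynomial (Fin n) ℂ) (x : Fin n → ℂ) : Fin n → ℂ :=
  fun i => MvPolynomial.eval x (F i)

/-- `g ∘ f = id` as rational maps of `ℙⁿ⁻¹`, for the rational maps `f` and `g` with lifts `F`, `G`:
the composition is defined at some point, and it maps `[x]` to `[x]` wherever it is defined. -/
def RationalLeftInverse {n : ℕ} (G F : Fin n → MvPolynomial (Fin n) ℂ) : Prop :=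
  (∃ x : Fin n → ℂ, x ≠ 0 ∧ polyMap G (polyMap F x) ≠ 0) ∧
    ∀ (x : Fin n → ℂ) (hx : x ≠ 0) (h : polyMap G (polyMap F x) ≠ 0),
      Projectivization.mk ℂ (polyMap G (polyMap F x)) h = Projectivization.mk ℂ x hx

/-- `F` is a quadratic lift of a Cremona transformation `f` of bidegree `(2, 2)` of `ℙⁿ⁻¹`, and `G` is
a quadratic lift of `f⁻¹`. -/
structure IsQuadroQuadricPair {n : ℕ} (F G : Fin n → MvPolynomial (Fin n) ℂ) : Prop where
  lift : IsLiftOfDegree 2 F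
  lift_inv : IsLiftOfDegree 2 G
  left_inv : RationalLeftInverse G F
  right_inv : RationalLeftInverse F G

/-- `N` is the cubic form associated with `F` and `G`: `G (F x) = N(x) x` for all `x`. -/
structure IsAssociatedCubicForm {n : ℕ} (F G : Fin n → MvPolynomial (Fin n) ℂ)
    (N : MvPolynomial (Fin n) ℂ) : Prop where
  homogeneous : N.IsHomogeneous 3
  eq_smul : ∀ x : Fin n → ℂ, polyMap G (polyMap F x) = MvPolynomial.eval x N • x

/-! ## The variety `X_f` -/

/-- Indices for the `2n + 2` homogeneous coordinates of `ℙ(ℂ ⊕ ℂⁿ ⊕ ℂⁿ ⊕ ℂ) = ℙ²ⁿ⁺¹`. -/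
abbrev FreudenthalIndex (n : ℕ) : Type := Unit ⊕ (Fin n ⊕ (Fin n ⊕ Unit))

/-- The vector `(1, x, F(x), N(x))`. -/
def muVec {n : ℕ} (F : Fin n → MvPolynomial (Fin n) ℂ) (N : MvPolynomial (Fin n) ℂ)
    (x : Fin n → ℂ) : FreudenthalIndex n → ℂ :=
  Sum.elim (fun _ => 1) (Sum.elim x (Sum.elim (polyMap F x) (fun _ => MvPolynomial.eval x N)))

theorem muVec_ne_zero {n : ℕ} (F : Fin n → MvPolynomial (Fin n) ℂ) (N : MvPolynomial (Fin n) ℂ)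
    (x : Fin n → ℂ) : muVec F N x ≠ 0 := fun h => by
  simpa [muVec] using congrFun h (Sum.inl ())

/-- The map `μ_f : ℂⁿ → ℙ²ⁿ⁺¹`, `x ↦ [1 : x : F(x) : N(x)]`. -/
def muMap {n : ℕ} (F : Fin n → MvPolynomial (Fin n) ℂ) (N : MvPolynomial (Fin n) ℂ)
    (x : Fin n → ℂ) : ProjSpace (FreudenthalIndex n) :=
  Projectivization.mk ℂ (muVec F N x) (muVec_ne_zero F N x)

/-- The variety `X_f`: the Zariski closure of the image of `μ_f`. -/
def varietyXf {n : ℕ} (F : Fin n → MvPolynomial (Fin n) ℂ) (N : MvPolynomial (Fin n) ℂ) :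
    Set (ProjSpace (FreudenthalIndex n)) :=
  closure (Set.range (muMap F N))

end

/-! Let `M` be the cubic form of the pair `(G, F)`, so that `F(G(y)) = M(y) y`; comparing the two
ways to compute `F(G(F(x)))` gives `M(F(x)) = N(x)²`. The decisive fact is that every partial
derivative of `N` is a linear combination of the `F i` (`exists_linear_pderiv_cubicForm`). By
Taylor's formula the translation `x ↦ x + a` then acts linearly on `(1, x, F(x), N(x))`
(`exists_translation`). The swap `(r, x, y, s) ↦ (s, y, x, r)` exchanges the cones over `X_f` and
`X_g` and realises `x ↦ F(x) / N(x)` (`freudenthalSwap_muVec`).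

Two translations and a swap carry the points `∞, 0, z` of `X_g` to three general points of `X_f`.
The first three lie on the twisted cubic `[s³ : s²t z : st² G(z) : t³ M(z)]`, whose image is the
required curve.

A scroll of dimension `n` contains an `(n - 1)`-dimensional linear space through each of its points.
On `X_f` such a space through `[1 : 0 : 0 : 0]` would give a hyperplane of `ℂⁿ` on which all `F i`
vanish, hence a common linear factor (`not_exists_linear_subspace`).

The dimension is bounded above by the `n + 1` parameters of the affine cone, and below by the
closures of the images of a flag of coordinate subspaces. Non-degeneracy follows by separating the
degrees 0, 1, 2, 3 in `x`, the quadratic part being settled by `F(G(y)) = M(y) y`. -/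

/-! ### Closed sets of projective space and ideals of affine cones -/

section ProjectiveZariski

open MvPolynomial

variable {σ : Type}

theorem MvPolynomial.IsHomogeneous.eval_smul {P : MvPolynomial σ ℂ} {d : ℕ}
    (hP : P.IsHomogeneous d) (c : ℂ) (x : σ → ℂ) : eval (c • x) P = c ^ d * eval x P := by
  rw [eval_eq, eval_eq, Finset.mul_sum]
  refine Finset.sum_congr rfl fun m hm => ?_
  have hd : ∑ i ∈ m.support, m i = d := by
    have := hP (mem_support_iff.mp hm)
    rw [Finsupp.weight_apply] at this
    simpa [Finsupp.sum] using this
  simp only [Pi.smul_apply, smul_eq_mul, mul_pow, Finset.prod_mul_distrib, Finset.prod_pow_eq_pow_sum,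
    hd]
  ring

theorem vanishesAt_mk {P : MvPolynomial σ ℂ} {d : ℕ} (hP : P.IsHomogeneous d) (v : σ → ℂ)
    (hv : v ≠ 0) : VanishesAt P (Projectivization.mk ℂ v hv) ↔ eval v P = 0 := by
  obtain ⟨a, ha⟩ := Projectivization.exists_smul_eq_mk_rep ℂ v hv
  rw [VanishesAt, ← ha, Units.smul_def, hP.eval_smul]
  simp

theorem isClosed_iff_isProjAlgebraicSet {Z : Set (ProjSpace σ)} :
    IsClosed Z ↔ IsProjAlgebraicSet Z := by
  rw [← isOpen_compl_iff]
  change Zᶜᶜ ∈ {Z | IsProjAlgebraicSet Z} ↔ _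
  rw [compl_compl]
  rfl

theorem isClosed_setOf_vanishesAt {P : MvPolynomial σ ℂ} {d : ℕ} (hP : P.IsHomogeneous d) :
    IsClosed {p : ProjSpace σ | VanishesAt P p} := by
  rw [isClosed_iff_isProjAlgebraicSet]
  refine ⟨{P}, ?_, by simp⟩
  rintro _ rfl
  exact ⟨d, hP⟩

/-- The ideal of all polynomials vanishing on the cone over `Z`. -/
def coneIdeal (Z : Set (ProjSpace σ)) : Ideal (MvPolynomial σ ℂ) where
  carrier := {P | ∀ (v : σ → ℂ) (hv : v ≠ 0), Projectivization.mk ℂ v hv ∈ Z → eval v P = 0}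
  add_mem' hP hQ v hv h := by rw [map_add, hP v hv h, hQ v hv h, add_zero]
  zero_mem' v _ _ := map_zero _
  smul_mem' c P hP v hv h := by rw [smul_eq_mul, map_mul, hP v hv h, mul_zero]

theorem mem_coneIdeal {Z : Set (ProjSpace σ)} {P : MvPolynomial σ ℂ} :
    P ∈ coneIdeal Z ↔
      ∀ (v : σ → ℂ) (hv : v ≠ 0), Projectivization.mk ℂ v hv ∈ Z → eval v P = 0 := Iff.rfl

theorem mem_coneIdeal_iff_of_isHomogeneous {Z : Set (ProjSpace σ)} {P : MvPolynomial σ ℂ} {d : ℕ}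
    (hP : P.IsHomogeneous d) : P ∈ coneIdeal Z ↔ ∀ p ∈ Z, VanishesAt P p := by
  constructor
  · intro h p hp
    induction p using Projectivization.ind with | h v hv =>
    exact (vanishesAt_mk hP v hv).2 (h v hv hp)
  · intro h v hv hp
    exact (vanishesAt_mk hP v hv).1 (h _ hp)

/-- Along the line `c ↦ c • v` the value of `P` is a polynomial in `c` whose coefficients are the
values of the homogeneous components at `v`; it has infinitely many roots. -/
theorem eval_homogeneousComponent_eq_zero {P : MvPolynomial σ ℂ} {v : σ → ℂ}
    (h : ∀ c : ℂ, c ≠ 0 → eval (c • v) P = 0) (d : ℕ) :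
    eval v (homogeneousComponent d P) = 0 := by
  set Q : Polynomial ℂ := ∑ i ∈ Finset.range (P.totalDegree + 1),
    Polynomial.monomial i (eval v (homogeneousComponent i P)) with hQ
  have hQ0 : Q = 0 := by
    apply Polynomial.eq_zero_of_infinite_isRoot
    refine Set.Infinite.mono (s := {0}ᶜ) ?_ (Set.finite_singleton (0 : ℂ)).infinite_compl
    intro c hc
    have := h c hc
    rw [← sum_homogeneousComponent P, map_sum] at this
    simp only [Set.mem_ofPred_eq, Polynomial.IsRoot.def, hQ, Polynomial.eval_finsetSum,
      Polynomial.eval_monomial]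
    rw [← this]
    refine Finset.sum_congr rfl fun i _ => ?_
    rw [(homogeneousComponent_isHomogeneous i P).eval_smul, mul_comm]
  by_cases hd : d ∈ Finset.range (P.totalDegree + 1)
  · have : Q.coeff d = 0 := by rw [hQ0, Polynomial.coeff_zero]
    rw [hQ, Polynomial.finsetSum_coeff] at this
    simpa [Polynomial.coeff_monomial, Finset.sum_ite_eq', hd] using this
  · rw [homogeneousComponent_eq_zero, map_zero]
    simpa [Nat.lt_succ_iff] using hd

theorem homogeneousComponent_mem_coneIdeal {Z : Set (ProjSpace σ)} {P : MvPolynomial σ ℂ}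
    (hP : P ∈ coneIdeal Z) (d : ℕ) : homogeneousComponent d P ∈ coneIdeal Z := by
  intro v hv hZ
  refine eval_homogeneousComponent_eq_zero (fun c hc => hP _ (smul_ne_zero hc hv) ?_) d
  convert! hZ using 1
  exact (Projectivization.mk_eq_mk_iff' ℂ _ _ _ _).2 ⟨c, rfl⟩

theorem mk_mem_closure_iff {Z : Set (ProjSpace σ)} {v : σ → ℂ} (hv : v ≠ 0) :
    Projectivization.mk ℂ v hv ∈ closure Z ↔
      ∀ (P : MvPolynomial σ ℂ) (d : ℕ), P.IsHomogeneous d → (∀ p ∈ Z, VanishesAt P p) →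
        eval v P = 0 := by
  constructor
  · intro h P d hP hZ
    exact (vanishesAt_mk hP v hv).1
      (closure_minimal (t := {p | VanishesAt P p}) hZ (isClosed_setOf_vanishesAt hP) h)
  · intro h
    rw [closure, Set.mem_sInter]
    rintro T ⟨hT, hZT⟩
    obtain ⟨S, hS, rfl⟩ := isClosed_iff_isProjAlgebraicSet.1 hT
    intro P hP
    obtain ⟨d, hd⟩ := hS P hP
    exact (vanishesAt_mk hd v hv).2 (h P d hd fun p hp => hZT hp P hP)

theorem coneIdeal_antitone {Z W : Set (ProjSpace σ)} (h : Z ⊆ W) : coneIdeal W ≤ coneIdeal Z :=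
  fun _ hP v hv hZ => hP v hv (h hZ)

theorem subset_of_coneIdeal_le {Z W : Set (ProjSpace σ)} (hW : IsClosed W)
    (h : coneIdeal W ≤ coneIdeal Z) : Z ⊆ W := by
  intro p hp
  induction p using Projectivization.ind with | h v hv =>
  rw [← hW.closure_eq, mk_mem_closure_iff]
  intro P d hP hPW
  exact h ((mem_coneIdeal_iff_of_isHomogeneous hP).2 hPW) v hv hp

/-- The ideal is homogeneous, so primality need only be tested on homogeneous elements, whose zero
loci are closed sets to which irreducibility applies. -/
theorem coneIdeal_isPrime {Z : Set (ProjSpace σ)} (hZ : IsIrreducible Z) :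
    (coneIdeal Z).IsPrime := by
  classical
  let _ : GradedAlgebra (homogeneousSubmodule σ ℂ) := gradedAlgebra
  refine Ideal.IsHomogeneous.isPrime_of_homogeneous_mem_or_mem
    (𝒜 := homogeneousSubmodule σ ℂ) ?_ ?_ ?_
  · intro d P hP
    have := homogeneousComponent_mem_coneIdeal hP d
    rwa [← decomposition.decompose'_apply] at this
  · obtain ⟨p, hp⟩ := hZ.1
    induction p using Projectivization.ind with | h v hv =>
    intro h
    have : (1 : MvPolynomial σ ℂ) ∈ coneIdeal Z := h ▸ Submodule.mem_top
    simpa using this v hv hp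
  · rintro P Q ⟨d, hP⟩ ⟨e, hQ⟩ hPQ
    rw [mem_homogeneousSubmodule] at hP hQ
    rw [mem_coneIdeal_iff_of_isHomogeneous hP, mem_coneIdeal_iff_of_isHomogeneous hQ]
    rw [mem_coneIdeal_iff_of_isHomogeneous (hP.mul hQ)] at hPQ
    refine (isPreirreducible_iff_isClosed_union_isClosed.1 hZ.2 _ _
      (isClosed_setOf_vanishesAt hP) (isClosed_setOf_vanishesAt hQ) ?_)
    intro p hp
    have := hPQ p hp
    rw [VanishesAt, map_mul] at this
    exact mul_eq_zero.1 this

/-- The ideal of the origin. -/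
noncomputable def originIdeal (σ : Type) : Ideal (MvPolynomial σ ℂ) := RingHom.ker (eval (0 : σ → ℂ))

instance (σ : Type) : (originIdeal σ).IsPrime := RingHom.ker_isPrime _

/-- This strict inclusion adds one more prime to every chain of cone ideals; it accounts for the
affine cone having one dimension more than the projective set. -/
theorem coneIdeal_lt_originIdeal {Z : Set (ProjSpace σ)} (hZ : Z.Nonempty) :
    coneIdeal Z < originIdeal σ := by
  obtain ⟨p, hp⟩ := hZ
  induction p using Projectivization.ind with | h v hv =>
  rw [SetLike.lt_iff_le_and_exists]
  constructor
  · intro P hP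
    have h := homogeneousComponent_mem_coneIdeal hP 0 v hv hp
    rw [homogeneousComponent_zero, eval_C] at h
    rw [originIdeal, RingHom.mem_ker]
    rwa [← constantCoeff_eq, ← eval_zero] at h
  · obtain ⟨i, hi⟩ := Function.ne_iff.1 hv
    refine ⟨X i, by simp [originIdeal, RingHom.mem_ker], fun h => hi ?_⟩
    simpa using h v hv hp

end ProjectiveZariski

/-! ### Upper bound for the dimension of a parametrized projective variety -/

section Dimension

open MvPolynomial TopologicalSpace Order

theorem ringKrullDim_le_of_isIntegral {A B : Type*} [CommRing A] [CommRing B] [Algebra A B]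
    [Algebra.IsIntegral A B] : ringKrullDim B ≤ ringKrullDim A := by
  refine krullDim_le_of_strictMono (fun p : PrimeSpectrum B => PrimeSpectrum.comap (algebraMap A B) p) ?_
  intro p q hpq
  exact Ideal.IsIntegral.comap_lt_comap (R := A) (I := p.asIdeal) (J := q.asIdeal) hpq

/-- The Krull dimension of the coordinate ring of a parametrized affine variety is at most the
number of parameters. -/
theorem ringKrullDim_quotient_ker_le {σ τ : Type} [Finite σ] [Finite τ]
    (ψ : MvPolynomial σ ℂ →ₐ[ℂ] MvPolynomial τ ℂ) :
    ringKrullDim (MvPolynomial σ ℂ ⧸ RingHom.ker ψ) ≤ Nat.card τ := by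
  have : Nontrivial (MvPolynomial σ ℂ ⧸ RingHom.ker ψ) :=
    Ideal.Quotient.nontrivial_iff.2 (RingHom.ker_ne_top ψ)
  -- Noether normalization: the quotient is integral over a polynomial ring in `s` variables. That
  -- ring embeds into `ℂ[τ]`, so transcendence degrees bound `s`.
  obtain ⟨s, g, hg, hint⟩ :=
    exists_integral_inj_algHom_of_fg ℂ (MvPolynomial σ ℂ ⧸ RingHom.ker ψ)
  have h1 : ringKrullDim (MvPolynomial σ ℂ ⧸ RingHom.ker ψ) ≤ s := by
    algebraize [g.toRingHom]
    refine (ringKrullDim_le_of_isIntegral (A := MvPolynomial (Fin s) ℂ)).trans ?_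
    simp
  have h2 : s ≤ Nat.card τ := by
    have h := trdeg_le_of_injective ((Ideal.kerLiftAlg ψ).comp g)
      ((Ideal.kerLiftAlg_injective ψ).comp hg)
    have := Fintype.ofFinite τ
    simpa [MvPolynomial.trdeg_of_isDomain] using h
  exact h1.trans (by exact_mod_cast h2)

/-- A chain of irreducible closed subsets of `X` gives a reversed chain of primes containing `ker
ψ`. Adding the ideal of the origin makes it longer by one, and its length is at most `n + 1`. -/
theorem topologicalKrullDim_le_of_ker_le_coneIdeal {σ τ : Type} [Finite σ] [Finite τ]
    (ψ : MvPolynomial σ ℂ →ₐ[ℂ] MvPolynomial τ ℂ) {X : Set (ProjSpace σ)} (hX : IsClosed X)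
    (hne : X.Nonempty) (h : RingHom.ker ψ ≤ coneIdeal X) {n : ℕ} (hn : Nat.card τ = n + 1) :
    topologicalKrullDim X ≤ n := by
  have hdim := ringKrullDim_quotient_ker_le ψ
  rw [ringKrullDim_quotient, hn] at hdim
  let f : IrreducibleCloseds X → IrreducibleCloseds (ProjSpace σ) :=
    IrreducibleCloseds.map Subtype.val continuous_subtype_val
  have hf : StrictMono f :=
    IrreducibleCloseds.map_strictMono_of_isInducing Topology.IsInducing.subtypeVal
  have hsub : ∀ Z : IrreducibleCloseds X, (f Z : Set (ProjSpace σ)) ⊆ X := by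
    intro Z
    refine closure_minimal ?_ hX
    rintro _ ⟨p, -, rfl⟩
    exact p.2
  let o : (PrimeSpectrum.zeroLocus (R := MvPolynomial σ ℂ) (RingHom.ker ψ))ᵒᵈ :=
    OrderDual.toDual ⟨⟨originIdeal σ, inferInstance⟩,
      fun P hP => (coneIdeal_lt_originIdeal hne).le (h hP)⟩
  let g : IrreducibleCloseds X →
      (PrimeSpectrum.zeroLocus (R := MvPolynomial σ ℂ) (RingHom.ker ψ))ᵒᵈ := fun Z =>
    OrderDual.toDual ⟨⟨coneIdeal (f Z : Set (ProjSpace σ)), coneIdeal_isPrime (f Z).isIrreducible⟩,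
      fun P hP => coneIdeal_antitone (hsub Z) (h hP)⟩
  have hg : StrictMono g := by
    intro Z W hZW
    have hlt := hf hZW
    rw [lt_iff_le_not_ge] at hlt
    change coneIdeal (f W : Set (ProjSpace σ)) < coneIdeal (f Z : Set (ProjSpace σ))
    rw [lt_iff_le_not_ge]
    exact ⟨coneIdeal_antitone hlt.1,
      fun hle => hlt.2 (subset_of_coneIdeal_le (f Z).isClosed hle)⟩
  have hog : ∀ Z, o < g Z := fun Z => by
    change coneIdeal (f Z : Set (ProjSpace σ)) < originIdeal σ
    exact coneIdeal_lt_originIdeal (f Z).isIrreducible.1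
  rw [← krullDim_orderDual] at hdim
  refine iSup_le fun p => ?_
  have hr : o < (p.map g hg).head := hog p.head
  have hlen := (LTSeries.length_le_krullDim ((p.map g hg).cons o hr)).trans hdim
  have hcons : ((p.map g hg).cons o hr).length = p.length + 1 := RelSeries.cons_length _ _ _
  rw [hcons] at hlen
  norm_cast at hlen ⊢
  omega

end Dimension

/-! ### Divisibility, homogeneity and substitution of polynomials -/

section PolynomialAlgebra

open MvPolynomial

/-- The gcd of the `b * f i` is `b` times the gcd of the `f i`, which is a unit. -/
theorem dvd_of_forall_dvd_mul {ι R : Type*} [Fintype ι] [CommRing R] [IsDomain R]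
    [UniqueFactorizationMonoid R] {f : ι → R} (hf : ∀ p : R, (∀ i, p ∣ f i) → IsUnit p) {a b : R}
    (h : ∀ i, a ∣ b * f i) : a ∣ b := by
  classical
  let _ : StrongNormalizationMonoid R := UniqueFactorizationMonoid.strongNormalizationMonoid
  let _ : NormalizedGCDMonoid R := UniqueFactorizationMonoid.toNormalizedGCDMonoid R
  have h1 : a ∣ Finset.univ.gcd fun i => b * f i := Finset.dvd_gcd fun i _ => h i
  have h2 := h1.trans (Finset.gcd_mul_left' Finset.univ f b).dvd
  have h3 : IsUnit (Finset.univ.gcd f) := hf _ fun i => Finset.gcd_dvd (Finset.mem_univ i)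
  exact h3.dvd_mul_right.1 h2

/-- The component of `A * B` of degree `m + j` is `A` times the component of `B` of degree `j`, so
the latter vanishes for `j ≠ k`. -/
theorem MvPolynomial.IsHomogeneous.of_mul_left {σ : Type*} {A B : MvPolynomial σ ℂ} {m k : ℕ}
    (hA : A.IsHomogeneous m) (hA0 : A ≠ 0) (hAB : (A * B).IsHomogeneous (m + k)) :
    B.IsHomogeneous k := by
  classical
  let _ : GradedAlgebra (homogeneousSubmodule σ ℂ) := gradedAlgebra
  have key : ∀ j, homogeneousComponent (m + j) (A * B) = A * homogeneousComponent j B := by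
    intro j
    have := DirectSum.coe_decompose_mul_add_of_left_mem (homogeneousSubmodule σ ℂ) (j := j)
      (b := B) ((mem_homogeneousSubmodule m A).2 hA)
    simp only [← decomposition.decompose'_apply]
    exact this
  rw [← sum_homogeneousComponent B]
  refine IsHomogeneous.sum _ _ _ fun j _ => ?_
  by_cases hj : j = k
  · subst hj
    exact homogeneousComponent_isHomogeneous j B
  · have h0 : A * homogeneousComponent j B = 0 := by
      rw [← key, homogeneousComponent_of_mem ((mem_homogeneousSubmodule _ _).2 hAB), if_neg (by omega)]
    rw [(mul_eq_zero.1 h0).resolve_left hA0]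
    exact isHomogeneous_zero _ _ _

theorem MvPolynomial.pderiv_bind₁ {σ τ R : Type*} [CommRing R] [Fintype σ]
    (F : σ → MvPolynomial τ R) (P : MvPolynomial σ R) (k : τ) :
    pderiv k (bind₁ F P) = ∑ j, bind₁ F (pderiv j P) * pderiv k (F j) := by
  classical
  induction P using MvPolynomial.induction_on with
  | C a => simp
  | add p q hp hq => simp only [map_add, hp, hq, add_mul, Finset.sum_add_distrib]
  | mul_X p i hp =>
    simp only [map_mul, bind₁_X_right, Derivation.leibniz, hp, smul_eq_mul, map_add, add_mul,
      Finset.sum_add_distrib, Finset.mul_sum, pderiv_X]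
    congr 1
    · simp [Pi.single_apply]
    · exact Finset.sum_congr rfl fun j _ => by ring

theorem eval_bind₁_eq {σ τ : Type*} (F : σ → MvPolynomial τ ℂ) (P : MvPolynomial σ ℂ)
    (x : τ → ℂ) : eval x (bind₁ F P) = eval (fun i => eval x (F i)) P := by
  rw [← coe_aeval_eq_eval, ← coe_aeval_eq_eval, RingHom.coe_coe, RingHom.coe_coe, aeval_bind₁]

theorem eval_bind₁_polyMap {n : ℕ} (F : Fin n → MvPolynomial (Fin n) ℂ) (P : MvPolynomial (Fin n) ℂ)
    (x : Fin n → ℂ) : eval x (bind₁ F P) = eval (polyMap F x) P :=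
  eval_bind₁_eq F P x

theorem polyMap_smul {n d : ℕ} {F : Fin n → MvPolynomial (Fin n) ℂ}
    (hF : ∀ i, (F i).IsHomogeneous d) (c : ℂ) (x : Fin n → ℂ) :
    polyMap F (c • x) = c ^ d • polyMap F x := by
  ext i
  exact (hF i).eval_smul c x

end PolynomialAlgebra

/-! ### The cubic form and its derivatives -/

section QuadroQuadric

open MvPolynomial

variable {n : ℕ} {F G : Fin n → MvPolynomial (Fin n) ℂ} {M N : MvPolynomial (Fin n) ℂ}

theorem IsQuadroQuadricPair.symm (h : IsQuadroQuadricPair F G) : IsQuadroQuadricPair G F :=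
  ⟨h.lift_inv, h.lift, h.right_inv, h.left_inv⟩

theorem IsLiftOfDegree.exists_ne_zero {d : ℕ} (h : IsLiftOfDegree d F) : ∃ i, F i ≠ 0 := by
  by_contra! h0
  exact not_isUnit_zero (h.coprime 0 fun i => by rw [h0 i])

/-- In one variable, Euler's identity makes `X 0` a common factor. -/
theorem IsLiftOfDegree.two_le (h : IsLiftOfDegree 2 F) : 2 ≤ n := by
  obtain ⟨i, hi⟩ := h.exists_ne_zero
  by_contra! hn
  obtain rfl : n = 1 := by have := i.2; omega
  have key : X 0 ∣ C 2 * F 0 := by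
    have := (h.homogeneous 0).sum_X_mul_pderiv
    rw [Fin.sum_univ_one] at this
    exact ⟨pderiv 0 (F 0), by rw [this, two_nsmul, map_ofNat, two_mul]⟩
  have hu : IsUnit (C 2 : MvPolynomial (Fin 1) ℂ) := (isUnit_iff_ne_zero.2 two_ne_zero).map C
  have hX : IsUnit (X 0 : MvPolynomial (Fin 1) ℂ) :=
    h.coprime _ fun j => by rw [Subsingleton.elim j 0]; exact hu.dvd_mul_left.1 key
  exact (X_prime (R := ℂ) (i := (0 : Fin 1))).not_isUnit hX

theorem RationalLeftInverse.X_mul_bind₁ (h : RationalLeftInverse G F) (i j : Fin n) :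
    X j * bind₁ F (G i) = X i * bind₁ F (G j) := by
  refine MvPolynomial.funext fun x => ?_
  simp only [map_mul, eval_X, eval_bind₁_polyMap]
  change x j * polyMap G (polyMap F x) i = x i * polyMap G (polyMap F x) j
  by_cases h0 : polyMap G (polyMap F x) = 0
  · simp [h0]
  by_cases hx : x = 0
  · simp [hx]
  obtain ⟨a, ha⟩ := (Projectivization.mk_eq_mk_iff' ℂ _ _ _ _).1 (h.2 x hx h0)
  rw [← ha]
  simp only [Pi.smul_apply, smul_eq_mul]
  ring

/-- Since `X j * G i(F) = X i * G j(F)` and the primes `X i`, `X j` are not associated for `i ≠ j`,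
`X i` divides `G i(F)`. The same relation shows that all the quotients coincide. -/
theorem IsQuadroQuadricPair.exists_cubicForm (h : IsQuadroQuadricPair F G) :
    ∃ N, IsAssociatedCubicForm F G N := by
  have hn := h.lift.two_le
  have hdvd : ∀ i, X i ∣ bind₁ F (G i) := by
    intro i
    have : Nontrivial (Fin n) := Fin.nontrivial_iff_two_le.2 hn
    obtain ⟨j, hj⟩ := exists_ne i
    refine ((X_prime (R := ℂ) (i := i)).dvd_or_dvd
      ⟨_, h.left_inv.X_mul_bind₁ i j⟩).resolve_left fun hd => hj ?_
    exact (X_dvd_X.1 hd).symm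
  choose K hK using hdvd
  let i₀ : Fin n := ⟨0, by omega⟩
  have hKeq : ∀ i, K i = K i₀ := by
    intro i
    have := h.left_inv.X_mul_bind₁ i i₀
    rw [hK i, hK i₀] at this
    refine mul_left_cancel₀ (mul_ne_zero (X_ne_zero i) (X_ne_zero i₀)) ?_
    linear_combination this
  refine ⟨K i₀, ?_, fun x => ?_⟩
  · refine (isHomogeneous_X ℂ i₀).of_mul_left (X_ne_zero _) (k := 3) ?_
    rw [← hK]
    exact (h.lift_inv.homogeneous i₀).aeval F h.lift.homogeneous
  · ext i
    have := congrArg (eval x) (hK i)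
    rw [eval_bind₁_polyMap, hKeq, map_mul, eval_X] at this
    simpa [polyMap, mul_comm] using this

theorem IsAssociatedCubicForm.bind₁_eq (hN : IsAssociatedCubicForm F G N) (i : Fin n) :
    bind₁ F (G i) = N * X i := by
  refine MvPolynomial.funext fun x => ?_
  rw [eval_bind₁_polyMap, map_mul, eval_X]
  exact congrFun (hN.eq_smul x) i

theorem IsAssociatedCubicForm.unique (hn : 0 < n) (hN : IsAssociatedCubicForm F G N)
    (hM : IsAssociatedCubicForm F G M) : M = N := by
  have := (hM.bind₁_eq ⟨0, hn⟩).symm.trans (hN.bind₁_eq ⟨0, hn⟩)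
  exact mul_right_cancel₀ (X_ne_zero _) this

theorem IsAssociatedCubicForm.ne_zero (h : IsQuadroQuadricPair F G)
    (hN : IsAssociatedCubicForm F G N) : N ≠ 0 := by
  rintro rfl
  obtain ⟨x, -, hx⟩ := h.left_inv.1
  exact hx (by rw [hN.eq_smul, map_zero, zero_smul])

/-- `F(G(F(x)))` is both `M(F(x)) F(x)` and `F(N(x) x) = N(x)² F(x)`; a nonzero component of `F` is
cancelled. -/
theorem bind₁_cubicForm (h : IsQuadroQuadricPair F G) (hN : IsAssociatedCubicForm F G N)
    (hM : IsAssociatedCubicForm G F M) : bind₁ F M = N ^ 2 := by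
  obtain ⟨i, hi⟩ := h.lift.exists_ne_zero
  refine mul_right_cancel₀ hi (MvPolynomial.funext fun x => ?_)
  have h1 := congrFun (hM.eq_smul (polyMap F x)) i
  rw [hN.eq_smul, polyMap_smul h.lift.homogeneous] at h1
  simp only [map_mul, map_pow, eval_bind₁_polyMap]
  exact h1.symm

theorem eval_cubicForm_polyMap (h : IsQuadroQuadricPair F G) (hN : IsAssociatedCubicForm F G N)
    (hM : IsAssociatedCubicForm G F M) (x : Fin n → ℂ) : eval (polyMap F x) M = eval x N ^ 2 := by
  rw [← eval_bind₁_polyMap, bind₁_cubicForm h hN hM, map_pow]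

/-- Differentiate `G i(F) = N * X i` in direction `k` and substitute `G`. The derivatives of `G i`
are linear forms and `F(G(y)) = M(y) y`, so the chain-rule terms are multiples of `M`; so is `N(G) =
M²`. What remains is `G i` times the derivative of `N` at `G`, and the `G i` have no common factor.
-/
theorem cubicForm_mul_comp (h : IsQuadroQuadricPair F G) (hN : IsAssociatedCubicForm F G N)
    (hM : IsAssociatedCubicForm G F M) (k : Fin n) : M ∣ bind₁ G (pderiv k N) := by
  refine dvd_of_forall_dvd_mul h.lift_inv.coprime fun i => ?_
  have h1 := congrArg (fun P => bind₁ G (pderiv k P)) (hN.bind₁_eq i)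
  simp only [pderiv_bind₁, map_sum, map_mul, Derivation.leibniz, smul_eq_mul, map_add, bind₁_bind₁,
    bind₁_X_right, hM.bind₁_eq, bind₁_cubicForm h.symm hM hN] at h1
  rw [eq_comm, ← eq_sub_iff_add_eq', mul_comm] at h1
  rw [h1]
  refine dvd_sub (Finset.dvd_sum fun j _ => Dvd.dvd.mul_right ?_ _)
    ((dvd_pow_self M two_ne_zero).mul_right _)
  have hd : ((pderiv j (G i)).IsHomogeneous 1) := (h.lift_inv.homogeneous i).pderiv
  refine ⟨pderiv j (G i), MvPolynomial.funext fun x => ?_⟩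
  rw [eval_bind₁_eq, map_mul, ← pow_one (eval x M), ← hd.eval_smul]
  simp [Pi.smul_def]

/-- The partial derivatives of the cubic form are linear combinations of the quadratic forms `F`. -/
theorem exists_linear_pderiv_cubicForm (h : IsQuadroQuadricPair F G)
    (hN : IsAssociatedCubicForm F G N) (k : Fin n) :
    ∃ L : MvPolynomial (Fin n) ℂ, L.IsHomogeneous 1 ∧ pderiv k N = bind₁ F L := by
  obtain ⟨M, hM⟩ := h.symm.exists_cubicForm
  have hM0 := hM.ne_zero h.symm
  have hN0 := hN.ne_zero h
  obtain ⟨L, hL⟩ := cubicForm_mul_comp h hN hM k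
  refine ⟨L, hM.homogeneous.of_mul_left hM0 ?_, ?_⟩
  · rw [← hL]
    exact hN.homogeneous.pderiv.aeval G h.lift_inv.homogeneous
  -- At `y = F(x)` the identity `(∂ₖN)(G(y)) = M(y) L(y)` reads `N(x)² ∂ₖN(x) = N(x)² L(F(x))`.
  · refine mul_left_cancel₀ (pow_ne_zero 2 hN0) (MvPolynomial.funext fun x => ?_)
    have h1 := congrArg (eval (polyMap F x)) hL
    rw [eval_bind₁_polyMap, map_mul, eval_cubicForm_polyMap h hN hM, hN.eq_smul,
      hN.homogeneous.pderiv.eval_smul] at h1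
    rw [map_mul, map_mul, map_pow, eval_bind₁_polyMap, ← h1]

end QuadroQuadric

/-! ### Taylor expansion of linear, quadratic and cubic forms -/

section Taylor

open MvPolynomial

variable {n : ℕ}

/-- The commutator of two derivations is a derivation, and this one kills the variables. -/
theorem MvPolynomial.pderiv_comm {σ R : Type*} [CommRing R] (i j : σ) (P : MvPolynomial σ R) :
    pderiv i (pderiv j P) = pderiv j (pderiv i P) := by
  classical
  have h : ⁅(pderiv i : Derivation R (MvPolynomial σ R) (MvPolynomial σ R)),
      (pderiv j : Derivation R (MvPolynomial σ R) (MvPolynomial σ R))⁆ = 0 := by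
    refine derivation_ext fun k => ?_
    simp [Derivation.commutator_apply, pderiv_X, Pi.single_apply, apply_ite]
  have := congrArg (fun D => D P) h
  simpa [Derivation.commutator_apply, sub_eq_zero] using this

/-- The derivative of the polynomial function `P` at `x` in the direction `a`. -/
noncomputable def dirDeriv (P : MvPolynomial (Fin n) ℂ) (x a : Fin n → ℂ) : ℂ :=
  ∑ k, a k * eval x (pderiv k P)

theorem dirDeriv_add_right (P : MvPolynomial (Fin n) ℂ) (x a b : Fin n → ℂ) :
    dirDeriv P x (a + b) = dirDeriv P x a + dirDeriv P x b := by
  simp [dirDeriv, add_mul, Finset.sum_add_distrib]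

theorem dirDeriv_smul_right (P : MvPolynomial (Fin n) ℂ) (x a : Fin n → ℂ) (c : ℂ) :
    dirDeriv P x (c • a) = c * dirDeriv P x a := by
  simp [dirDeriv, mul_assoc, Finset.mul_sum]

theorem dirDeriv_self {P : MvPolynomial (Fin n) ℂ} {d : ℕ} (hP : P.IsHomogeneous d)
    (x : Fin n → ℂ) : dirDeriv P x x = d * eval x P := by
  have := congrArg (eval x) hP.sum_X_mul_pderiv
  simpa [dirDeriv] using this

theorem eval_of_isHomogeneous_one {P : MvPolynomial (Fin n) ℂ} (hP : P.IsHomogeneous 1)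
    (x a : Fin n → ℂ) : eval x P = dirDeriv P a x := by
  have h1 := dirDeriv_self hP x
  rw [Nat.cast_one, one_mul] at h1
  rw [← h1]
  refine Finset.sum_congr rfl fun k _ => ?_
  have h0 : (pderiv k P).IsHomogeneous 0 := hP.pderiv
  rw [← totalDegree_zero_iff_isHomogeneous, totalDegree_eq_zero_iff_eq_C] at h0
  rw [h0, eval_C, eval_C]

theorem eval_add_of_isHomogeneous_one {P : MvPolynomial (Fin n) ℂ} (hP : P.IsHomogeneous 1)
    (x a : Fin n → ℂ) : eval (x + a) P = eval x P + eval a P := by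
  rw [eval_of_isHomogeneous_one hP (x + a) 0, dirDeriv_add_right, ← eval_of_isHomogeneous_one hP,
    ← eval_of_isHomogeneous_one hP]

theorem dirDeriv_symm {P : MvPolynomial (Fin n) ℂ} (hP : P.IsHomogeneous 2)
    (x a : Fin n → ℂ) : dirDeriv P x a = dirDeriv P a x := by
  have h : ∀ u v : Fin n → ℂ, dirDeriv P u v =
      ∑ k, ∑ l, v k * (u l * eval 0 (pderiv l (pderiv k P))) := by
    intro u v
    refine Finset.sum_congr rfl fun k _ => ?_
    rw [eval_of_isHomogeneous_one (hP.pderiv (i := k)) u 0, dirDeriv, Finset.mul_sum]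
  rw [h, h, Finset.sum_comm]
  refine Finset.sum_congr rfl fun k _ => Finset.sum_congr rfl fun l _ => ?_
  rw [pderiv_comm]
  ring

/-- Euler's identity at `x + a`, expanded bilinearly; the cubic case below proceeds likewise from
the quadratic expansion of the partial derivatives. -/
theorem eval_add_of_isHomogeneous_two {P : MvPolynomial (Fin n) ℂ} (hP : P.IsHomogeneous 2)
    (x a : Fin n → ℂ) : eval (x + a) P = eval x P + dirDeriv P a x + eval a P := by
  have h := dirDeriv_self hP (x + a)
  have hl : ∀ v, dirDeriv P (x + a) v = dirDeriv P x v + dirDeriv P a v := by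
    intro v
    simp only [dirDeriv, eval_add_of_isHomogeneous_one (hP.pderiv), mul_add,
      Finset.sum_add_distrib]
  rw [hl, dirDeriv_add_right, dirDeriv_add_right, dirDeriv_self hP, dirDeriv_self hP,
    dirDeriv_symm hP x a] at h
  push_cast at h
  linear_combination -h / 2

theorem eval_add_of_isHomogeneous_three {P : MvPolynomial (Fin n) ℂ} (hP : P.IsHomogeneous 3)
    (x a : Fin n → ℂ) :
    eval (x + a) P = eval x P + dirDeriv P x a + dirDeriv P a x + eval a P := by
  have hd : ∀ k, (pderiv k P).IsHomogeneous 2 := fun k => hP.pderiv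
  have hq : ∀ v, dirDeriv P (x + a) v =
      dirDeriv P x v + ∑ k, v k * dirDeriv (pderiv k P) a x + dirDeriv P a v := by
    intro v
    simp only [dirDeriv, eval_add_of_isHomogeneous_two (hd _), mul_add, Finset.sum_add_distrib]
  -- Euler's identity for the quadratic forms `∂ₗP`, after exchanging the mixed derivatives.
  have hs : ∀ u v : Fin n → ℂ, ∑ k, u k * dirDeriv (pderiv k P) u v = 2 * dirDeriv P u v := by
    intro u v
    simp only [dirDeriv, Finset.mul_sum]
    rw [Finset.sum_comm]
    refine Finset.sum_congr rfl fun l _ => ?_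
    have := dirDeriv_self (hd l) u
    push_cast at this
    rw [mul_left_comm, ← this, dirDeriv, Finset.mul_sum]
    refine Finset.sum_congr rfl fun k _ => ?_
    rw [pderiv_comm]
    ring
  have h := dirDeriv_self hP (x + a)
  have h1 : ∑ k, x k * dirDeriv (pderiv k P) a x = 2 * dirDeriv P x a := by
    rw [← hs]
    exact Finset.sum_congr rfl fun k _ => by rw [dirDeriv_symm (hd k)]
  rw [dirDeriv_add_right, hq, hq, hs, h1, dirDeriv_self hP, dirDeriv_self hP] at h
  push_cast at h
  linear_combination -h / 3

end Taylor

/-! ### Linear symmetries of the ambient space: swap and translations -/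

section FreudenthalSpace

open MvPolynomial

variable {n : ℕ} {F G : Fin n → MvPolynomial (Fin n) ℂ} {M N : MvPolynomial (Fin n) ℂ}

/-- The vector `(r, x, y, s)` of `ℂ ⊕ ℂⁿ ⊕ ℂⁿ ⊕ ℂ`. -/
def freudenthalVec (r : ℂ) (x y : Fin n → ℂ) (s : ℂ) : FreudenthalIndex n → ℂ :=
  Sum.elim (fun _ => r) (Sum.elim x (Sum.elim y fun _ => s))

theorem exists_eq_freudenthalVec (v : FreudenthalIndex n → ℂ) :
    ∃ r x y s, v = freudenthalVec r x y s := by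
  refine ⟨v (.inl ()), fun i => v (.inr (.inl i)), fun i => v (.inr (.inr (.inl i))),
    v (.inr (.inr (.inr ()))), ?_⟩
  ext (_ | _ | _ | _) <;> rfl

theorem freudenthalVec_inj {r r' s s' : ℂ} {x x' y y' : Fin n → ℂ} :
    freudenthalVec r x y s = freudenthalVec r' x' y' s' ↔ r = r' ∧ x = x' ∧ y = y' ∧ s = s' := by
  constructor
  · intro h
    refine ⟨congrFun h (.inl ()), funext fun i => congrFun h (.inr (.inl i)),
      funext fun i => congrFun h (.inr (.inr (.inl i))), congrFun h (.inr (.inr (.inr ())))⟩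
  · rintro ⟨rfl, rfl, rfl, rfl⟩
    rfl

theorem freudenthalVec_add (r r' s s' : ℂ) (x x' y y' : Fin n → ℂ) :
    freudenthalVec r x y s + freudenthalVec r' x' y' s' =
      freudenthalVec (r + r') (x + x') (y + y') (s + s') := by
  ext (_ | _ | _ | _) <;> rfl

theorem smul_freudenthalVec (c r s : ℂ) (x y : Fin n → ℂ) :
    c • freudenthalVec r x y s = freudenthalVec (c * r) (c • x) (c • y) (c * s) := by
  ext (_ | _ | _ | _) <;> rfl

theorem freudenthalVec_zero : freudenthalVec 0 (0 : Fin n → ℂ) 0 0 = 0 := by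
  ext (_ | _ | _ | _) <;> rfl

theorem muVec_eq_freudenthalVec (x : Fin n → ℂ) :
    muVec F N x = freudenthalVec 1 x (polyMap F x) (eval x N) := rfl

/-- The linear involution `(r, x, y, s) ↦ (s, y, x, r)`. -/
def freudenthalSwap (n : ℕ) : (FreudenthalIndex n → ℂ) →ₗ[ℂ] (FreudenthalIndex n → ℂ) where
  toFun v := freudenthalVec (v (.inr (.inr (.inr ())))) (fun i => v (.inr (.inr (.inl i))))
    (fun i => v (.inr (.inl i))) (v (.inl ()))
  map_add' v w := by ext (_ | _ | _ | _) <;> rfl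
  map_smul' c v := by ext (_ | _ | _ | _) <;> rfl

theorem freudenthalSwap_apply (r s : ℂ) (x y : Fin n → ℂ) :
    freudenthalSwap n (freudenthalVec r x y s) = freudenthalVec s y x r := rfl

theorem freudenthalSwap_injective : Function.Injective (freudenthalSwap n) := by
  refine Function.LeftInverse.injective (g := freudenthalSwap n) fun v => ?_
  obtain ⟨r, x, y, s, rfl⟩ := exists_eq_freudenthalVec v
  rfl

theorem eval_linear {L : MvPolynomial (Fin n) ℂ} (hL : L.IsHomogeneous 1) (c : ℂ) (x : Fin n → ℂ) :
    eval (c • x) L = c * eval x L := by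
  rw [hL.eval_smul, pow_one]

/-- The translations of `ℂⁿ` are induced by linear automorphisms of the ambient space of `X_f`. -/
theorem exists_translation (h : IsQuadroQuadricPair F G) (hN : IsAssociatedCubicForm F G N)
    (a : Fin n → ℂ) :
    ∃ T : (FreudenthalIndex n → ℂ) →ₗ[ℂ] (FreudenthalIndex n → ℂ), Function.Injective T ∧
      (∀ x, T (muVec F N x) = muVec F N (x + a)) ∧
      T (freudenthalVec 0 0 0 1) = freudenthalVec 0 0 0 1 := by
  choose L hL1 hL using exists_linear_pderiv_cubicForm h hN
  let q : (Fin n → ℂ) → ℂ := fun y => ∑ k, a k * eval y (L k)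
  have hq_add : ∀ y z, q (y + z) = q y + q z := by
    intro y z
    simp only [q, eval_add_of_isHomogeneous_one (hL1 _), mul_add, Finset.sum_add_distrib]
  have hq_smul : ∀ (c : ℂ) y, q (c • y) = c * q y := by
    intro c y
    simp only [q, eval_linear (hL1 _), Finset.mul_sum, mul_left_comm]
  have hq : ∀ x, dirDeriv N x a = q (polyMap F x) := by
    intro x
    simp only [dirDeriv, hL, eval_bind₁_polyMap, q]
  -- The Taylor expansions at `x + a`, homogenised by `r`. The only term not visibly linear, the
  -- derivative of `N` at `x` along `a`, is the linear form `q` in `y = F(x)`.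
  let t : ℂ → (Fin n → ℂ) → (Fin n → ℂ) → ℂ → FreudenthalIndex n → ℂ := fun r x y s =>
    freudenthalVec r (x + r • a) (y + (fun i => dirDeriv (F i) a x) + r • polyMap F a)
      (s + q y + dirDeriv N a x + r * eval a N)
  let T : (FreudenthalIndex n → ℂ) →ₗ[ℂ] (FreudenthalIndex n → ℂ) :=
    { toFun := fun v => t (v (.inl ())) (fun i => v (.inr (.inl i)))
        (fun i => v (.inr (.inr (.inl i)))) (v (.inr (.inr (.inr ()))))
      map_add' := fun v w => by
        obtain ⟨r, x, y, s, rfl⟩ := exists_eq_freudenthalVec v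
        obtain ⟨r', x', y', s', rfl⟩ := exists_eq_freudenthalVec w
        rw [freudenthalVec_add]
        change t (r + r') (x + x') (y + y') (s + s') = t r x y s + t r' x' y' s'
        simp only [t, freudenthalVec_add, freudenthalVec_inj, hq_add, dirDeriv_add_right]
        refine ⟨trivial, ?_, ?_, by ring⟩
        · module
        · ext i
          simp only [Pi.add_apply, Pi.smul_apply, smul_eq_mul]
          ring
      map_smul' := fun c v => by
        obtain ⟨r, x, y, s, rfl⟩ := exists_eq_freudenthalVec v
        rw [smul_freudenthalVec]
        change t (c * r) (c • x) (c • y) (c * s) = c • t r x y s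
        simp only [t, smul_freudenthalVec, freudenthalVec_inj, hq_smul, dirDeriv_smul_right]
        refine ⟨trivial, ?_, ?_, by ring⟩
        · module
        · ext i
          simp only [Pi.add_apply, Pi.smul_apply, smul_eq_mul]
          ring }
  have hT : ∀ r x y s, T (freudenthalVec r x y s) = t r x y s := fun r x y s => rfl
  have hd0 : ∀ P : MvPolynomial (Fin n) ℂ, dirDeriv P a 0 = 0 := fun P => by simp [dirDeriv]
  have hq0 : q 0 = 0 := by simpa using hq_smul 0 0
  refine ⟨T, ?_, ?_, ?_⟩
  · rw [injective_iff_map_eq_zero]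
    intro v hv
    obtain ⟨r, x, y, s, rfl⟩ := exists_eq_freudenthalVec v
    rw [hT, ← freudenthalVec_zero, freudenthalVec_inj] at hv
    obtain ⟨rfl, hx, hy, hs⟩ := hv
    obtain rfl : x = 0 := by simpa using hx
    obtain rfl : y = 0 := by
      simp only [hd0, zero_smul, add_zero] at hy
      rwa [← Pi.zero_def, add_zero] at hy
    obtain rfl : s = 0 := by simpa [hd0, hq0] using hs
    exact freudenthalVec_zero
  · intro x
    rw [muVec_eq_freudenthalVec, muVec_eq_freudenthalVec, hT, freudenthalVec_inj]
    refine ⟨rfl, by rw [one_smul], ?_, ?_⟩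
    · ext i
      simp only [polyMap, eval_add_of_isHomogeneous_two (h.lift.homogeneous i), Pi.add_apply,
        one_smul]
    · rw [eval_add_of_isHomogeneous_three hN.homogeneous, hq, one_mul]
  · rw [hT, freudenthalVec_inj]
    refine ⟨rfl, by simp, ?_, by simp [hd0, hq0]⟩
    ext i
    simp [hd0]

end FreudenthalSpace

/-! ### The affine cone over the variety -/

section ConeOverVariety

open MvPolynomial

theorem MvPolynomial.IsHomogeneous.bind₁_linear {σ τ : Type} [Fintype τ] {P : MvPolynomial σ ℂ} {d : ℕ}
    (hP : P.IsHomogeneous d) (c : σ → τ → ℂ) :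
    (bind₁ (fun i => ∑ j, C (c i j) * X j) P).IsHomogeneous d := by
  have := hP.aeval (fun i => ∑ j, C (c i j) * X j) (n := 1) fun i =>
    IsHomogeneous.sum _ _ _ fun j _ => isHomogeneous_C_mul_X _ _
  rwa [one_mul] at this

/-- Pullback of homogeneous polynomials along a linear map. -/
theorem MvPolynomial.IsHomogeneous.exists_pullback {σ τ : Type} [Fintype τ]
    {P : MvPolynomial σ ℂ} {d : ℕ} (hP : P.IsHomogeneous d) (T : (τ → ℂ) →ₗ[ℂ] (σ → ℂ)) :
    ∃ Q : MvPolynomial τ ℂ, Q.IsHomogeneous d ∧ ∀ v, eval v Q = eval (T v) P := by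
  classical
  refine ⟨_, IsHomogeneous.bind₁_linear hP fun i j => T (Pi.single j 1) i, fun v => ?_⟩
  rw [eval_bind₁_eq]
  congr 2
  ext i
  have hs : ∀ j : τ, (fun k => if j = k then (1 : ℂ) else 0) = Pi.single j 1 := by
    intro j
    ext k
    simp [Pi.single_apply, eq_comm]
  conv_rhs => rw [LinearMap.pi_apply_eq_sum_univ T v]
  simp [hs, mul_comm]

variable {n : ℕ} {F G : Fin n → MvPolynomial (Fin n) ℂ} {M N : MvPolynomial (Fin n) ℂ}

/-- The vector `v` lies in the affine cone over `X_f`. -/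
def InFreudenthalCone (F : Fin n → MvPolynomial (Fin n) ℂ) (N : MvPolynomial (Fin n) ℂ)
    (v : FreudenthalIndex n → ℂ) : Prop :=
  ∀ (P : MvPolynomial (FreudenthalIndex n) ℂ) (d : ℕ), P.IsHomogeneous d →
    (∀ x, eval (muVec F N x) P = 0) → eval v P = 0

theorem mk_mem_varietyXf_iff {v : FreudenthalIndex n → ℂ} (hv : v ≠ 0) :
    Projectivization.mk ℂ v hv ∈ varietyXf F N ↔ InFreudenthalCone F N v := by
  rw [varietyXf, mk_mem_closure_iff hv]
  refine forall_congr' fun P => forall_congr' fun d => forall_congr' fun hP => ?_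
  rw [Set.forall_mem_range]
  simp only [muMap, vanishesAt_mk hP]

theorem mem_varietyXf_iff {p : ProjSpace (FreudenthalIndex n)} :
    p ∈ varietyXf F N ↔ InFreudenthalCone F N p.rep := by
  rw [← mk_mem_varietyXf_iff p.rep_nonzero, p.mk_rep]

theorem inFreudenthalCone_muVec (x : Fin n → ℂ) : InFreudenthalCone F N (muVec F N x) :=
  fun _ _ _ h => h x

theorem InFreudenthalCone.smul {v : FreudenthalIndex n → ℂ} (hv : InFreudenthalCone F N v) (c : ℂ) :
    InFreudenthalCone F N (c • v) := fun P d hP h => by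
  rw [hP.eval_smul, hv P d hP h, mul_zero]

/-- The polynomials `(1, x, F, N)`. -/
noncomputable def muPoly (F : Fin n → MvPolynomial (Fin n) ℂ) (N : MvPolynomial (Fin n) ℂ) :
    FreudenthalIndex n → MvPolynomial (Fin n) ℂ :=
  Sum.elim (fun _ => 1) (Sum.elim X (Sum.elim F fun _ => N))

theorem eval_bind₁_muPoly (P : MvPolynomial (FreudenthalIndex n) ℂ) (x : Fin n → ℂ) :
    eval x (bind₁ (muPoly F N) P) = eval (muVec F N x) P := by
  rw [eval_bind₁_eq]
  congr 2
  ext (_ | _ | _ | _) <;> simp [muPoly, muVec, polyMap]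

/-- It suffices to control `T` off the hypersurface `D = 0`: the pulled-back equation times `D`
vanishes identically, and `D` can be cancelled. -/
theorem InFreudenthalCone.map {F' : Fin n → MvPolynomial (Fin n) ℂ} {N' : MvPolynomial (Fin n) ℂ}
    (T : (FreudenthalIndex n → ℂ) →ₗ[ℂ] (FreudenthalIndex n → ℂ)) {D : MvPolynomial (Fin n) ℂ}
    (hD : D ≠ 0) (hT : ∀ x, eval x D ≠ 0 → InFreudenthalCone F' N' (T (muVec F N x)))
    {v : FreudenthalIndex n → ℂ} (hv : InFreudenthalCone F N v) :
    InFreudenthalCone F' N' (T v) := by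
  intro P d hP h
  obtain ⟨Q, hQ, hQe⟩ := hP.exists_pullback T
  rw [← hQe]
  refine hv Q d hQ fun x => ?_
  have h0 : bind₁ (muPoly F N) Q * D = 0 := by
    refine MvPolynomial.funext fun y => ?_
    rw [map_mul, map_zero, eval_bind₁_muPoly, hQe]
    by_cases hy : eval y D = 0
    · rw [hy, mul_zero]
    · rw [hT y hy P d hP h, zero_mul]
  rw [← eval_bind₁_muPoly, (mul_eq_zero.1 h0).resolve_right hD, map_zero]

theorem polyMap_inv_smul (h : IsQuadroQuadricPair F G) (hN : IsAssociatedCubicForm F G N)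
    {u : Fin n → ℂ} (hu : eval u N ≠ 0) :
    polyMap G ((eval u N)⁻¹ • polyMap F u) = (eval u N)⁻¹ • u := by
  rw [polyMap_smul h.lift_inv.homogeneous, hN.eq_smul, smul_smul]
  congr 1
  field_simp

theorem eval_cubicForm_inv_smul (h : IsQuadroQuadricPair F G) (hN : IsAssociatedCubicForm F G N)
    (hM : IsAssociatedCubicForm G F M) {u : Fin n → ℂ} (hu : eval u N ≠ 0) :
    eval ((eval u N)⁻¹ • polyMap F u) M = (eval u N)⁻¹ := by
  rw [hM.homogeneous.eval_smul, eval_cubicForm_polyMap h hN hM]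
  field_simp

/-- With `w = F(u) / N(u)` one has `G(w) = u / N(u)` and `M(w) = 1 / N(u)`. -/
theorem freudenthalSwap_muVec (h : IsQuadroQuadricPair F G) (hN : IsAssociatedCubicForm F G N)
    (hM : IsAssociatedCubicForm G F M) {u : Fin n → ℂ} (hu : eval u N ≠ 0) :
    freudenthalSwap n (muVec F N u) =
      eval u N • muVec G M ((eval u N)⁻¹ • polyMap F u) := by
  rw [muVec_eq_freudenthalVec, muVec_eq_freudenthalVec, freudenthalSwap_apply, smul_freudenthalVec,
    polyMap_inv_smul h hN hu, eval_cubicForm_inv_smul h hN hM hu, mul_one, smul_inv_smul₀ hu,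
    smul_inv_smul₀ hu, mul_inv_cancel₀ hu]

theorem InFreudenthalCone.swap (h : IsQuadroQuadricPair F G) (hN : IsAssociatedCubicForm F G N)
    (hM : IsAssociatedCubicForm G F M) {v : FreudenthalIndex n → ℂ}
    (hv : InFreudenthalCone F N v) : InFreudenthalCone G M (freudenthalSwap n v) := by
  refine hv.map _ (hN.ne_zero h) fun x hx => ?_
  rw [freudenthalSwap_muVec h hN hM hx]
  exact (inFreudenthalCone_muVec _).smul _

theorem muVec_zero (h : IsQuadroQuadricPair F G) (hN : IsAssociatedCubicForm F G N) :
    muVec F N 0 = freudenthalVec 1 0 0 0 := by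
  rw [muVec_eq_freudenthalVec, freudenthalVec_inj]
  refine ⟨rfl, rfl, ?_, ?_⟩
  · have := polyMap_smul h.lift.homogeneous 0 0
    simpa using this
  · have := hN.homogeneous.eval_smul 0 0
    simpa using this

theorem inFreudenthalCone_infinity (h : IsQuadroQuadricPair F G)
    (hN : IsAssociatedCubicForm F G N) : InFreudenthalCone F N (freudenthalVec 0 0 0 1) := by
  obtain ⟨M, hM⟩ := h.symm.exists_cubicForm
  have := (inFreudenthalCone_muVec (F := G) (N := M) 0).swap h.symm hM hN
  rwa [muVec_zero h.symm hM, freudenthalSwap_apply] at this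

/-- For `s ≠ 0` the vector is `s³` times the one parametrized by `(t / s) z`; for `s = 0` it is a
multiple of the point at infinity. -/
theorem inFreudenthalCone_curve (h : IsQuadroQuadricPair F G) (hN : IsAssociatedCubicForm F G N)
    (z : Fin n → ℂ) (s t : ℂ) :
    InFreudenthalCone F N (freudenthalVec (s ^ 3) ((s ^ 2 * t) • z) ((s * t ^ 2) • polyMap F z)
      (t ^ 3 * eval z N)) := by
  by_cases hs : s = 0
  · subst hs
    have := (inFreudenthalCone_infinity h hN).smul (t ^ 3 * eval z N)
    rw [smul_freudenthalVec] at this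
    simpa using this
  · have := (inFreudenthalCone_muVec (F := F) (N := N) ((s⁻¹ * t) • z)).smul (s ^ 3)
    rw [muVec_eq_freudenthalVec, smul_freudenthalVec, polyMap_smul h.lift.homogeneous,
      hN.homogeneous.eval_smul, smul_smul, smul_smul] at this
    convert! this using 2
    · ring
    · congr 1
      field_simp
    · congr 1
      field_simp
    · field_simp

theorem InFreudenthalCone.equations (hF : ∀ i, (F i).IsHomogeneous 2) (hN : N.IsHomogeneous 3)
    {r s : ℂ} {x y : Fin n → ℂ} (hv : InFreudenthalCone F N (freudenthalVec r x y s)) :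
    polyMap F x = r • y ∧ eval x N = r ^ 2 * s := by
  constructor
  · ext i
    have := hv (rename (fun j => .inr (.inl j)) (F i) - X (.inl ()) * X (.inr (.inr (.inl i)))) 2
      (((hF i).rename_isHomogeneous).sub ((isHomogeneous_X _ _).mul (isHomogeneous_X _ _))) ?_
    · rw [map_sub, eval_rename, sub_eq_zero] at this
      simp only [map_mul, eval_X] at this
      exact this
    · intro u
      rw [map_sub, eval_rename, sub_eq_zero, map_mul, eval_X, eval_X]
      exact (one_mul _).symm
  · have := hv (rename (fun j => .inr (.inl j)) N - X (.inl ()) ^ 2 * X (.inr (.inr (.inr ())))) 3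
      ((hN.rename_isHomogeneous).sub (((isHomogeneous_X _ _).pow 2).mul (isHomogeneous_X _ _))) ?_
    · rw [map_sub, eval_rename, sub_eq_zero] at this
      simp only [map_mul, map_pow, eval_X] at this
      exact this
    · intro u
      rw [map_sub, eval_rename, sub_eq_zero, map_mul, map_pow, eval_X, eval_X]
      change eval u N = 1 ^ 2 * eval u N
      rw [one_pow, one_mul]

/-- Where `r ≠ 0`, the equations `F(x) = r y` and `N(x) = r² s` determine `y` and `s`. Thus taking
the closure adds no points in this chart. -/
theorem InFreudenthalCone.exists_eq_smul_muVec (hF : ∀ i, (F i).IsHomogeneous 2)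
    (hN : N.IsHomogeneous 3) {v : FreudenthalIndex n → ℂ} (hv : InFreudenthalCone F N v)
    (hr : v (.inl ()) ≠ 0) : ∃ x, v = v (.inl ()) • muVec F N x := by
  obtain ⟨r, x, y, s, rfl⟩ := exists_eq_freudenthalVec v
  change r ≠ 0 at hr
  obtain ⟨h1, h2⟩ := hv.equations hF hN
  refine ⟨r⁻¹ • x, ?_⟩
  change _ = r • _
  rw [muVec_eq_freudenthalVec, smul_freudenthalVec, freudenthalVec_inj, polyMap_smul hF,
    hN.eval_smul, h1, h2]
  refine ⟨(mul_one r).symm, (smul_inv_smul₀ hr x).symm, ?_, ?_⟩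
  · rw [smul_smul, smul_smul]
    field_simp
    rw [one_smul]
  · field_simp

end ConeOverVariety

/-! ### Twisted cubics through three general points -/

section TwistedCubics

open MvPolynomial

theorem MvPolynomial.IsWeightedHomogeneous.bind₁ {σ τ : Type} {w : τ → ℕ} {g : σ → MvPolynomial τ ℂ}
    {m d : ℕ} {P : MvPolynomial σ ℂ} (hP : P.IsHomogeneous d)
    (hg : ∀ i, (g i).IsWeightedHomogeneous w m) :
    (bind₁ g P).IsWeightedHomogeneous w (d * m) := by
  rw [← aeval_eq_bind₁, aeval_def, eval₂_eq]
  refine IsWeightedHomogeneous.sum _ _ _ fun e he => ?_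
  have hd : ∑ i ∈ e.support, e i = d := by
    have := hP (mem_support_iff.mp he)
    rw [Finsupp.weight_apply] at this
    simpa [Finsupp.sum] using this
  have := IsWeightedHomogeneous.prod e.support (fun i => g i ^ e i) (fun i => e i • m) (w := w)
    fun i _ => (hg i).pow (e i)
  have h2 := this.C_mul (coeff e P)
  simp only [smul_eq_mul, ← Finset.sum_mul, hd] at h2
  exact h2

variable {n : ℕ} {F G : Fin n → MvPolynomial (Fin n) ℂ} {M N : MvPolynomial (Fin n) ℂ}

/-- For points `x₁, x₂, x₃` in general position, a linear automorphism mapping the cone over `X_g` to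
the cone over `X_f` and the images of `∞, 0, z` to those of `x₁, x₂, x₃`. -/
theorem exists_linear_of_triple (h : IsQuadroQuadricPair F G) (hN : IsAssociatedCubicForm F G N)
    (hM : IsAssociatedCubicForm G F M) {x₁ x₂ x₃ y z : Fin n → ℂ} (h₂ : eval (x₂ - x₁) N ≠ 0)
    (h₃ : eval (x₃ - x₁) N ≠ 0) (hy : y = (eval (x₂ - x₁) N)⁻¹ • polyMap F (x₂ - x₁))
    (hz : z + y = (eval (x₃ - x₁) N)⁻¹ • polyMap F (x₃ - x₁)) :
    ∃ Φ : (FreudenthalIndex n → ℂ) →ₗ[ℂ] (FreudenthalIndex n → ℂ), Function.Injective Φ ∧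
      (∀ v, InFreudenthalCone G M v → InFreudenthalCone F N (Φ v)) ∧
      Φ (freudenthalVec 0 0 0 1) = muVec F N x₁ ∧
      (∃ c : ℂ, c ≠ 0 ∧ Φ (muVec G M 0) = c • muVec F N x₂) ∧
      ∃ c : ℂ, c ≠ 0 ∧ Φ (muVec G M z) = c • muVec F N x₃ := by
  obtain ⟨T, hT, hTmu, -⟩ := exists_translation h hN x₁
  obtain ⟨S, hS, hSmu, hSinf⟩ := exists_translation h.symm hM y
  -- The composite sends `w` to `w + y = F(x - x₁) / N(x - x₁)`, then to `x - x₁`, then to `x`. The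
  -- point at infinity is fixed by `S`, swapped to the origin and translated to `x₁`.
  have key : ∀ w x, eval (x - x₁) N ≠ 0 →
      w + y = (eval (x - x₁) N)⁻¹ • polyMap F (x - x₁) →
      ∃ c : ℂ, c ≠ 0 ∧ (T ∘ₗ freudenthalSwap n ∘ₗ S) (muVec G M w) = c • muVec F N x := by
    intro w x hx hw
    have hMw : eval (w + y) M = (eval (x - x₁) N)⁻¹ := by
      rw [hw, eval_cubicForm_inv_smul h hN hM hx]
    have hMw0 : eval (w + y) M ≠ 0 := by rw [hMw]; exact inv_ne_zero hx
    refine ⟨eval (w + y) M, hMw0, ?_⟩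
    rw [LinearMap.comp_apply, LinearMap.comp_apply, hSmu, freudenthalSwap_muVec h.symm hM hN hMw0,
      map_smul, hTmu, hMw, hw, polyMap_inv_smul h hN hx, inv_inv, smul_inv_smul₀ hx,
      sub_add_cancel]
  refine ⟨T ∘ₗ freudenthalSwap n ∘ₗ S, hT.comp (freudenthalSwap_injective.comp hS), ?_, ?_,
    key 0 x₂ h₂ (by rw [zero_add, hy]), key z x₃ h₃ hz⟩
  · intro v hv
    have h1 : InFreudenthalCone G M (S v) :=
      hv.map S one_ne_zero fun x _ => by rw [hSmu]; exact inFreudenthalCone_muVec _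
    exact (h1.swap h.symm hM hN).map T one_ne_zero fun x _ => by
      rw [hTmu]; exact inFreudenthalCone_muVec _
  · rw [LinearMap.comp_apply, LinearMap.comp_apply, hSinf, freudenthalSwap_apply,
      ← muVec_zero h hN, hTmu, zero_add]

theorem linearIndependent_coordinate_vectors {z w : Fin n → ℂ} {m : ℂ} (hz : z ≠ 0) (hw : w ≠ 0)
    (hm : m ≠ 0) : LinearIndependent ℂ ![freudenthalVec 1 (0 : Fin n → ℂ) 0 0,
      freudenthalVec 0 z 0 0, freudenthalVec 0 0 w 0, freudenthalVec 0 0 0 m] := by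
  rw [Fintype.linearIndependent_iff]
  intro g hg
  simp only [Fin.sum_univ_four, Matrix.cons_val_zero, Matrix.cons_val_one, Matrix.cons_val,
    smul_freudenthalVec, freudenthalVec_add] at hg
  rw [← freudenthalVec_zero, freudenthalVec_inj] at hg
  simp only [mul_zero, mul_one, smul_zero, add_zero, zero_add, smul_eq_zero, mul_eq_zero, hz, hw, hm,
    or_false] at hg
  obtain ⟨h0, h1, h2, h3⟩ := hg
  intro i
  fin_cases i
  exacts [h0, h1, h2, h3]

theorem exists_twistedCubic (h : IsQuadroQuadricPair F G) (hN : IsAssociatedCubicForm F G N)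
    (hM : IsAssociatedCubicForm G F M) {x : Fin 3 → Fin n → ℂ} (h₂ : eval (x 1 - x 0) N ≠ 0)
    (h₃ : eval (x 2 - x 0) N ≠ 0)
    (hz : eval (eval (x 1 - x 0) N • polyMap F (x 2 - x 0) -
      eval (x 2 - x 0) N • polyMap F (x 1 - x 0)) M ≠ 0) :
    ∃ C : Set (ProjSpace (FreudenthalIndex n)), IsTwistedCubic C ∧ C ⊆ varietyXf F N ∧
      ∀ k, muMap F N (x k) ∈ C := by
  set y := (eval (x 1 - x 0) N)⁻¹ • polyMap F (x 1 - x 0) with hy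
  set z := (eval (x 2 - x 0) N)⁻¹ • polyMap F (x 2 - x 0) - y with hzdef
  -- Up to the factor `N(x₁ - x₀) N(x₂ - x₀)`, `z` is the vector in `hz`.
  have hMz : eval z M ≠ 0 := by
    intro h0
    apply hz
    have : eval (x 1 - x 0) N • polyMap F (x 2 - x 0) - eval (x 2 - x 0) N • polyMap F (x 1 - x 0) =
        (eval (x 1 - x 0) N * eval (x 2 - x 0) N) • z := by
      rw [hzdef, hy, smul_sub, smul_smul, smul_smul]
      congr 2 <;> field_simp
    rw [this, hM.homogeneous.eval_smul, h0, mul_zero]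
  have hz0 : z ≠ 0 := by
    intro h0
    apply hMz
    have := hM.homogeneous.eval_smul 0 z
    rw [h0] at this ⊢
    simpa using this
  have hGz : polyMap G z ≠ 0 := by
    intro h0
    have h1 := hM.eq_smul z
    rw [h0] at h1
    have h2 := polyMap_smul h.lift.homogeneous 0 0
    rw [zero_smul, zero_pow two_ne_zero, zero_smul] at h2
    rw [h2] at h1
    exact (smul_ne_zero hMz hz0) h1.symm
  obtain ⟨Φ, hΦ, hcone, hinf, ⟨c₂, hc₂, hΦ₂⟩, c₃, hc₃, hΦ₃⟩ :=
    exists_linear_of_triple h hN hM h₂ h₃ hy (z := z) (by rw [hzdef, sub_add_cancel])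
  set c : Fin 4 → FreudenthalIndex n → ℂ := Φ ∘ ![freudenthalVec 1 (0 : Fin n → ℂ) 0 0,
      freudenthalVec 0 z 0 0, freudenthalVec 0 0 (polyMap G z) 0,
      freudenthalVec 0 0 0 (eval z M)] with hc
  have hsum : ∀ s t : ℂ, ∑ k : Fin 4, (s ^ (3 - (k : ℕ)) * t ^ (k : ℕ)) • c k =
      Φ (freudenthalVec (s ^ 3) ((s ^ 2 * t) • z) ((s * t ^ 2) • polyMap G z)
        (t ^ 3 * eval z M)) := by
    intro s t
    simp only [hc, Function.comp_apply, ← map_smul, ← map_sum]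
    congr 1
    simp only [Fin.sum_univ_four, Matrix.cons_val_zero, Matrix.cons_val_one, Matrix.cons_val,
      smul_freudenthalVec, freudenthalVec_add, freudenthalVec_inj]
    refine ⟨?_, ?_, ?_, ?_⟩ <;> simp
  refine ⟨_, ⟨c, ?_, rfl⟩, ?_, ?_⟩
  · exact (linearIndependent_coordinate_vectors hz0 hGz hMz).map'
      Φ (LinearMap.ker_eq_bot.2 hΦ)
  · rintro _ ⟨s, t, -, hne, rfl⟩
    rw [mk_mem_varietyXf_iff, hsum]
    exact hcone _ (inFreudenthalCone_curve h.symm hM z s t)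
  · have hmem : ∀ (k : Fin 3) (s t a : ℂ), (s, t) ≠ 0 → a ≠ 0 →
        Φ (freudenthalVec (s ^ 3) ((s ^ 2 * t) • z) ((s * t ^ 2) • polyMap G z)
          (t ^ 3 * eval z M)) = a • muVec F N (x k) →
        muMap F N (x k) ∈ {p | ∃ s t : ℂ, (s, t) ≠ 0 ∧
          ∃ h : (∑ k : Fin 4, (s ^ (3 - (k : ℕ)) * t ^ (k : ℕ)) • c k) ≠ 0,
            p = Projectivization.mk ℂ _ h} := by
      intro k s t a hst ha heq
      rw [← hsum] at heq
      have hne : (∑ k : Fin 4, (s ^ (3 - (k : ℕ)) * t ^ (k : ℕ)) • c k) ≠ 0 := by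
        rw [heq]
        exact smul_ne_zero ha (muVec_ne_zero _ _ _)
      refine ⟨s, t, hst, hne, ((Projectivization.mk_eq_mk_iff' ℂ _ _ _ _).2 ⟨a⁻¹, ?_⟩)⟩
      rw [heq, inv_smul_smul₀ ha]
    rw [Fin.forall_fin_succ, Fin.forall_fin_succ, Fin.forall_fin_succ]
    -- The parameters `[0 : 1]`, `[1 : 0]`, `[1 : 1]` give `∞`, `0` and `z`.
    refine ⟨hmem _ 0 1 (eval z M) (by simp) hMz ?_, hmem _ 1 0 c₂ (by simp) hc₂ ?_,
      hmem _ 1 1 c₃ (by simp) hc₃ ?_, fun i => i.elim0⟩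
    · rw [← hinf, ← map_smul, smul_freudenthalVec]
      congr 1
      simp
    · rw [muVec_zero h.symm hM] at hΦ₂
      simpa using hΦ₂
    · rw [muVec_eq_freudenthalVec] at hΦ₃
      simpa using hΦ₃

/-- The tri-homogeneous polynomial describing the triples of points in general position. -/
noncomputable def triplePoly (F : Fin n → MvPolynomial (Fin n) ℂ) (M N : MvPolynomial (Fin n) ℂ) :
    MvPolynomial (Fin 3 × FreudenthalIndex n) ℂ :=
  let r : Fin 3 → MvPolynomial (Fin 3 × FreudenthalIndex n) ℂ := fun k => X (k, .inl ())
  -- Up to the factor `r 0 * r k`, this is the difference of the affine points `k` and `0`.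
  let u : Fin 3 → Fin n → MvPolynomial (Fin 3 × FreudenthalIndex n) ℂ := fun k i =>
    r 0 * X (k, .inr (.inl i)) - r k * X (0, .inr (.inl i))
  r 0 * r 1 * r 2 * bind₁ (u 1) N * bind₁ (u 2) N *
    -- The factors `r 2` and `r 1` give both terms the same multidegree.
    bind₁ (fun i => r 2 * bind₁ (u 2) (F i) * bind₁ (u 1) N -
      r 1 * bind₁ (u 1) (F i) * bind₁ (u 2) N) M

theorem triplePoly_isTriHomogeneous (hF : ∀ i, (F i).IsHomogeneous 2) (hM : M.IsHomogeneous 3)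
    (hN : N.IsHomogeneous 3) : IsTriHomogeneous (triplePoly F M N) := by
  intro k
  have hX : ∀ v : Fin 3 × FreudenthalIndex n,
      (X v : MvPolynomial (Fin 3 × FreudenthalIndex n) ℂ).IsWeightedHomogeneous
        (fun v => if v.1 = k then 1 else 0) (if v.1 = k then 1 else 0) := fun v =>
    isWeightedHomogeneous_X ℂ _ v
  let d : Fin 3 → ℕ := fun j => if j = k then 1 else 0
  have hu : ∀ (j : Fin 3) (i : Fin n), (X (0, .inl ()) * X (j, .inr (.inl i)) -
      X (j, .inl ()) * X (0, .inr (.inl i)) :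
        MvPolynomial (Fin 3 × FreudenthalIndex n) ℂ).IsWeightedHomogeneous
          (fun v => if v.1 = k then 1 else 0) (d 0 + d j) := by
    intro j i
    refine ((hX _).mul (hX _)).sub ?_
    rw [add_comm]
    exact (hX _).mul (hX _)
  refine ⟨_, (((((hX _).mul (hX _)).mul (hX _)).mul (.bind₁ hN (hu 1))).mul
    (.bind₁ hN (hu 2))).mul (.bind₁ hM (m := d 2 + 2 * (d 0 + d 2) + 3 * (d 0 + d 1)) fun i => ?_)⟩
  refine (((hX _).mul (.bind₁ (hF i) (hu 2))).mul (.bind₁ hN (hu 1))).sub ?_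
  have := (((hX (1, .inl ())).mul (.bind₁ (hF i) (hu 1))).mul (.bind₁ hN (hu 2)))
  convert! this using 1
  change d 2 + 2 * (d 0 + d 2) + 3 * (d 0 + d 1) = d 1 + 2 * (d 0 + d 1) + 3 * (d 0 + d 2)
  ring

theorem eval_triplePoly (hF : ∀ i, (F i).IsHomogeneous 2) (hM : M.IsHomogeneous 3)
    (hN : N.IsHomogeneous 3) (c : Fin 3 → ℂ) (x : Fin 3 → Fin n → ℂ) :
    eval (fun v : Fin 3 × FreudenthalIndex n => (c v.1 • muVec F N (x v.1)) v.2)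
        (triplePoly F M N) =
      (c 0 ^ 22 * c 1 ^ 13 * c 2 ^ 13) * (eval (x 1 - x 0) N * eval (x 2 - x 0) N *
        eval (eval (x 1 - x 0) N • polyMap F (x 2 - x 0) -
          eval (x 2 - x 0) N • polyMap F (x 1 - x 0)) M) := by
  have hr : ∀ k, (c k • muVec F N (x k)) (.inl ()) = c k := fun k => mul_one _
  have hx : ∀ k i, (c k • muVec F N (x k)) (.inr (.inl i)) = c k * x k i := fun k i => rfl
  have hu : ∀ k, (fun i => c 0 * (c k * x k i) - c k * (c 0 * x 0 i)) =
      (c 0 * c k) • (x k - x 0) := by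
    intro k
    ext i
    simp only [Pi.smul_apply, Pi.sub_apply, smul_eq_mul]
    ring
  simp only [triplePoly, map_mul, map_sub, eval_X, eval_bind₁_eq, hr, hx, hu, hN.eval_smul,
    (hF _).eval_smul]
  have hw : (fun i => c 2 * ((c 0 * c 2) ^ 2 * eval (x 2 - x 0) (F i)) *
        ((c 0 * c 1) ^ 3 * eval (x 1 - x 0) N) -
      c 1 * ((c 0 * c 1) ^ 2 * eval (x 1 - x 0) (F i)) *
        ((c 0 * c 2) ^ 3 * eval (x 2 - x 0) N)) =
      (c 0 ^ 5 * c 1 ^ 3 * c 2 ^ 3) • (eval (x 1 - x 0) N • polyMap F (x 2 - x 0) -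
          eval (x 2 - x 0) N • polyMap F (x 1 - x 0)) := by
    ext i
    simp only [Pi.smul_apply, Pi.sub_apply, smul_eq_mul, polyMap]
    ring
  rw [hw, hM.eval_smul]
  ring

theorem rep_muMap (x : Fin n → ℂ) : ∃ c : ℂ, c ≠ 0 ∧ (muMap F N x).rep = c • muVec F N x := by
  obtain ⟨a, ha⟩ := Projectivization.exists_smul_eq_mk_rep ℂ _ (muVec_ne_zero F N x)
  exact ⟨a, a.ne_zero, ha.symm⟩

theorem isThreeRC_varietyXf (h : IsQuadroQuadricPair F G) (hN : IsAssociatedCubicForm F G N) :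
    IsThreeRCByTwistedCubics (varietyXf F N) := by
  obtain ⟨M, hM⟩ := h.symm.exists_cubicForm
  have hF := h.lift.homogeneous
  refine ⟨triplePoly F M N, triplePoly_isTriHomogeneous hF hM.homogeneous hN.homogeneous, ?_, ?_⟩
  · obtain ⟨a, ha⟩ : ∃ a, eval a N ≠ 0 := by
      by_contra! h0
      exact hN.ne_zero h (MvPolynomial.funext fun x => by rw [h0, map_zero])
    -- On the triple `0, a, 2a` the argument of `M` is `-4 N(a) F(a)`, and `M(F(a)) = N(a)² ≠ 0`.
    let x : Fin 3 → Fin n → ℂ := ![0, a, (2 : ℂ) • a]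
    refine ⟨fun k => muMap F N (x k), fun k => subset_closure ⟨x k, rfl⟩, ?_⟩
    choose c hc hrep using fun k => rep_muMap (F := F) (N := N) (x k)
    simp only [hrep]
    rw [eval_triplePoly hF hM.homogeneous hN.homogeneous]
    have hx0 : x 0 = 0 := rfl
    have hx1 : x 1 = a := rfl
    have hx2 : x 2 = (2 : ℂ) • a := rfl
    have hvec : eval a N • polyMap F ((2 : ℂ) • a) - eval ((2 : ℂ) • a) N • polyMap F a =
        (-4 * eval a N) • polyMap F a := by
      rw [polyMap_smul hF, hN.homogeneous.eval_smul, smul_smul, ← sub_smul]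
      congr 1
      ring
    rw [hx0, hx1, hx2, sub_zero, sub_zero, hvec, hN.homogeneous.eval_smul,
      hM.homogeneous.eval_smul, eval_cubicForm_polyMap h hN hM]
    simp [hc, ha]
  · intro p hp hP
    have hrep : ∀ k, InFreudenthalCone F N (p k).rep := fun k => mem_varietyXf_iff.1 (hp k)
    have hr : ∀ k, (p k).rep (.inl ()) ≠ 0 := by
      intro k h0
      apply hP
      have h3 : (p 0).rep (.inl ()) = 0 ∨ (p 1).rep (.inl ()) = 0 ∨ (p 2).rep (.inl ()) = 0 := by
        fin_cases k
        exacts [.inl h0, .inr (.inl h0), .inr (.inr h0)]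
      simp only [triplePoly, map_mul, eval_X]
      rcases h3 with h3 | h3 | h3 <;> simp [h3]
    choose x hx using fun k => (hrep k).exists_eq_smul_muVec hF hN.homogeneous (hr k)
    have hpx : ∀ k, p k = muMap F N (x k) := by
      intro k
      rw [← (p k).mk_rep]
      exact (Projectivization.mk_eq_mk_iff' ℂ _ _ _ _).2 ⟨_, (hx k).symm⟩
    have hfun : (fun v : Fin 3 × FreudenthalIndex n => (p v.1).rep v.2) =
        fun v => ((p v.1).rep (.inl ()) • muVec F N (x v.1)) v.2 := by
      ext v
      rw [← hx]
    rw [hfun, eval_triplePoly hF hM.homogeneous hN.homogeneous (fun k => (p k).rep (.inl ()))] at hP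
    obtain ⟨h12, hz⟩ := mul_ne_zero_iff.1 (right_ne_zero_of_mul hP)
    obtain ⟨h1, h2⟩ := mul_ne_zero_iff.1 h12
    obtain ⟨C, hC, hCX, hCp⟩ := exists_twistedCubic h hN hM h1 h2 hz
    exact ⟨C, hC, hCX, fun k => hpx k ▸ hCp k⟩

end TwistedCubics

/-! ### Linear subspaces: the variety is not a scroll -/

section NotScroll

open MvPolynomial

variable {n : ℕ} {F G : Fin n → MvPolynomial (Fin n) ℂ} {M N : MvPolynomial (Fin n) ℂ}

/-- A polynomial vanishing on a hyperplane is divisible by the linear form defining it. -/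
theorem linearForm_dvd_of_eval_eq_zero {c : Fin n → ℂ} (hc : c ≠ 0) {P : MvPolynomial (Fin n) ℂ}
    (hP : ∀ x, ∑ i, c i * x i = 0 → eval x P = 0) : (∑ i, C (c i) * X i) ∣ P := by
  classical
  obtain ⟨k, hk⟩ := Function.ne_iff.1 hc
  set φ : MvPolynomial (Fin n) ℂ := ∑ i, C (c i) * X i with hφ
  -- Since `φ(v) = 1`, the substitution `x ↦ x - φ(x) v` projects onto the hyperplane, so it kills
  -- `P`; modulo `φ` it is the identity.
  let v : Fin n → ℂ := Pi.single k (c k)⁻¹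
  have hv : ∑ i, c i * v i = 1 := by
    simp [v, Pi.single_apply, mul_inv_cancel₀ hk]
  have h0 : bind₁ (fun i => X i - C (v i) * φ) P = 0 := by
    refine MvPolynomial.funext fun x => ?_
    rw [eval_bind₁_eq, map_zero]
    refine hP _ ?_
    simp only [map_sub, map_mul, eval_X, eval_C, mul_sub, Finset.sum_sub_distrib]
    simp only [← mul_assoc, ← Finset.sum_mul, hv, hφ, map_sum, map_mul, eval_X, eval_C, one_mul,
      sub_self]
  have h1 : Ideal.Quotient.mkₐ ℂ (Ideal.span {φ}) (bind₁ (fun i => X i - C (v i) * φ) P) =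
      Ideal.Quotient.mkₐ ℂ (Ideal.span {φ}) P := by
    have : (Ideal.Quotient.mkₐ ℂ (Ideal.span {φ})).comp (bind₁ fun i => X i - C (v i) * φ) =
        Ideal.Quotient.mkₐ ℂ (Ideal.span {φ}) := by
      refine algHom_ext fun i => ?_
      simp only [AlgHom.comp_apply, bind₁_X_right, Ideal.Quotient.mkₐ_eq_mk]
      rw [Ideal.Quotient.mk_eq_mk_iff_sub_mem, Ideal.mem_span_singleton]
      exact ⟨-C (v i), by ring⟩
    exact DFunLike.congr_fun this P
  rw [h0, map_zero, eq_comm, Ideal.Quotient.mkₐ_eq_mk, Ideal.Quotient.eq_zero_iff_mem,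
    Ideal.mem_span_singleton] at h1
  exact h1

theorem linearForm_not_isUnit {c : Fin n → ℂ} : ¬ IsUnit (∑ i, C (c i) * X i :
    MvPolynomial (Fin n) ℂ) := by
  intro h
  have := h.map (eval (0 : Fin n → ℂ))
  simp at this

/-- The cone over `X_f` contains no `n`-dimensional linear subspace through `(1, 0, 0, 0)`. -/
theorem not_exists_linear_subspace (h : IsQuadroQuadricPair F G)
    (hN : IsAssociatedCubicForm F G N) (W : Submodule ℂ (FreudenthalIndex n → ℂ))
    (hW : Module.finrank ℂ W = n) (h0 : freudenthalVec 1 0 0 0 ∈ W)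
    (hcone : ∀ v ∈ W, InFreudenthalCone F N v) : False := by
  have hF := h.lift.homogeneous
  have key : ∀ r x y s, freudenthalVec r x y s ∈ W → polyMap F x = 0 ∧ y = 0 ∧ s = 0 := by
    intro r x y s hv
    -- As `W` contains `(1, 0, 0, 0)`, the coordinate `r` can be changed freely; comparing `r' = 0`
    -- and `r' = 1` forces `y = 0` and `s = 0`.
    have h1 : ∀ r', polyMap F x = r' • y ∧ eval x N = r' ^ 2 * s := by
      intro r'
      have : freudenthalVec r' x y s ∈ W := by
        have := W.add_mem hv (W.smul_mem (r' - r) h0)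
        rw [smul_freudenthalVec, freudenthalVec_add] at this
        simpa using this
      exact (hcone _ this).equations hF hN.homogeneous
    have hFx : polyMap F x = 0 := by simpa using (h1 0).1
    have hNx : eval x N = 0 := by simpa using (h1 0).2
    refine ⟨hFx, ?_, ?_⟩
    · simpa [hFx, eq_comm] using (h1 1).1
    · simpa [hNx, eq_comm] using (h1 1).2
  let π : (FreudenthalIndex n → ℂ) →ₗ[ℂ] ℂ × (Fin n → ℂ) :=
    (LinearMap.proj (.inl ())).prod (LinearMap.funLeft ℂ ℂ fun i => .inr (.inl i))
  have hinj : Function.Injective (π ∘ₗ W.subtype) := by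
    rw [injective_iff_map_eq_zero]
    rintro ⟨v, hv⟩ h1
    obtain ⟨r, x, y, s, rfl⟩ := exists_eq_freudenthalVec v
    obtain ⟨-, rfl, rfl⟩ := key r x y s hv
    have h2 : (r, x) = (0 : ℂ × (Fin n → ℂ)) := h1
    obtain ⟨rfl, rfl⟩ := Prod.mk.injEq _ _ _ _ ▸ h2
    exact Subtype.ext freudenthalVec_zero
  let H : Submodule ℂ (ℂ × (Fin n → ℂ)) := LinearMap.range (π ∘ₗ W.subtype)
  have hH : Module.finrank ℂ H = n := by
    exact (LinearEquiv.ofInjective _ hinj).finrank_eq.symm.trans hW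
  have hH0 : ((1 : ℂ), (0 : Fin n → ℂ)) ∈ H := ⟨⟨_, h0⟩, rfl⟩
  have hHF : ∀ r x, (r, x) ∈ H → polyMap F x = 0 := by
    rintro r x ⟨⟨v, hv⟩, h1⟩
    obtain ⟨r', x', y, s, rfl⟩ := exists_eq_freudenthalVec v
    have h2 : (r', x') = (r, x) := h1
    obtain ⟨rfl, rfl⟩ := Prod.mk.injEq _ _ _ _ ▸ h2
    exact (key _ _ _ _ hv).1
  have hHtop : H < ⊤ := by
    refine lt_top_iff_ne_top.2 fun ht => ?_
    rw [ht, finrank_top] at hH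
    simp at hH
  -- `H` is a hyperplane of `ℂ × ℂⁿ` containing `(1, 0)`, so its equation involves `x` only; that
  -- linear form divides every `F i`.
  obtain ⟨f, hf0, hf⟩ := Submodule.exists_le_ker_of_lt_top H hHtop
  have hker : H = LinearMap.ker f := by
    refine Submodule.eq_of_le_of_finrank_eq hf ?_
    have h1 := LinearMap.finrank_range_add_finrank_ker f
    have h2 : LinearMap.range f = ⊤ := LinearMap.range_eq_top.2 (LinearMap.surjective hf0)
    rw [h2, finrank_top] at h1
    simp at h1
    omega
  classical
  let c : Fin n → ℂ := fun i => f (0, Pi.single i 1)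
  have hfx : ∀ r x, f (r, x) = ∑ i, c i * x i := by
    intro r x
    have h1 : (r, x) = r • ((1 : ℂ), (0 : Fin n → ℂ)) + LinearMap.inr ℂ ℂ _ x := by simp
    have h2 : f ((1 : ℂ), (0 : Fin n → ℂ)) = 0 := hf hH0
    have hs : ∀ i : Fin n, (fun k => if i = k then (1 : ℂ) else 0) = Pi.single i 1 := by
      intro i
      ext k
      simp [Pi.single_apply, eq_comm]
    rw [h1, map_add, map_smul, h2, smul_zero, zero_add, ← LinearMap.comp_apply,
      LinearMap.pi_apply_eq_sum_univ]
    refine Finset.sum_congr rfl fun i _ => ?_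
    rw [smul_eq_mul, mul_comm, hs]
    rfl
  have hc : c ≠ 0 := by
    intro h1
    refine hf0 (LinearMap.ext fun p => ?_)
    rw [← Prod.mk.eta (p := p), hfx, h1]
    simp
  refine linearForm_not_isUnit (c := c) (h.lift.coprime _ fun i => ?_)
  refine linearForm_dvd_of_eval_eq_zero hc fun x hx => ?_
  refine congrFun (hHF 0 x ?_) i
  rw [hker, LinearMap.mem_ker, hfx, hx]

/-- Every point of a rational normal scroll of dimension `n` lies on an `(n - 1)`-dimensional linear
space contained in the scroll. -/
theorem exists_ruling {a : Fin n → ℕ} {p : ProjSpace (Σ i : Fin n, Fin (a i + 1))}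
    (hp : p ∈ standardScroll a) :
    ∃ W : Submodule ℂ ((Σ i : Fin n, Fin (a i + 1)) → ℂ), Module.finrank ℂ W = n ∧ p.rep ∈ W ∧
      ∀ v (hv : v ≠ 0), v ∈ W → Projectivization.mk ℂ v hv ∈ standardScroll a := by
  obtain ⟨s, t, hst, l, hl⟩ := hp
  let A : (Fin n → ℂ) →ₗ[ℂ] ((Σ i : Fin n, Fin (a i + 1)) → ℂ) :=
    { toFun := fun l ij => l ij.1 * (s ^ (a ij.1 - (ij.2 : ℕ)) * t ^ (ij.2 : ℕ))
      map_add' := fun l m => by ext; simp [add_mul]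
      map_smul' := fun c l => by ext; simp [mul_assoc] }
  have hA : Function.Injective A := by
    rw [injective_iff_map_eq_zero]
    intro l hl0
    ext i
    -- The extreme coordinates of block `i` are `l i * s ^ a i` and `l i * t ^ a i`, and `s`, `t`
    -- are not both zero.
    by_cases hs : s = 0
    · have ht : t ≠ 0 := fun ht => hst (by rw [hs, ht]; rfl)
      have := congrFun hl0 ⟨i, Fin.last (a i)⟩
      simpa [A, ht] using this
    · have := congrFun hl0 ⟨i, 0⟩
      simpa [A, hs] using this
  refine ⟨LinearMap.range A, ?_, ⟨l, ?_⟩, ?_⟩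
  · rw [LinearMap.finrank_range_of_inj hA, Module.finrank_fin_fun]
  · ext ⟨i, j⟩
    exact (hl i j).symm
  · rintro _ hv ⟨m, rfl⟩
    obtain ⟨b, hb⟩ := Projectivization.exists_smul_eq_mk_rep ℂ _ hv
    refine ⟨s, t, hst, fun i => b * m i, fun i j => ?_⟩
    rw [← hb]
    change (b : ℂ) * (m i * _) = _
    rw [mul_assoc]

theorem not_isRationalNormalScroll_varietyXf (h : IsQuadroQuadricPair F G)
    (hN : IsAssociatedCubicForm F G N) : ¬ IsRationalNormalScroll n (varietyXf F N) := by
  rintro ⟨a, -, e, he⟩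
  have h0 : muMap F N 0 ∈ varietyXf F N := subset_closure ⟨0, rfl⟩
  rw [← he] at h0
  obtain ⟨p, hp, hpe⟩ := h0
  obtain ⟨W, hW, hpW, hWs⟩ := exists_ruling hp
  refine not_exists_linear_subspace h hN (W.map e.toLinearMap) ?_ ?_ ?_
  · exact (LinearEquiv.finrank_map_eq e W).trans hW
  · rw [← p.mk_rep, Projectivization.map_mk, muMap, Projectivization.mk_eq_mk_iff',
      muVec_zero h hN] at hpe
    obtain ⟨c, hc⟩ := hpe
    have hc0 : c ≠ 0 := by
      rintro rfl
      rw [zero_smul] at hc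
      exact p.rep_nonzero (e.injective (by rw [map_zero]; exact hc.symm))
    rw [← inv_smul_smul₀ hc0 (freudenthalVec 1 0 0 0), hc]
    exact Submodule.smul_mem _ _ (Submodule.mem_map_of_mem hpW)
  · rintro _ ⟨v, hv, rfl⟩
    by_cases hv0 : v = 0
    · subst hv0
      rw [map_zero, ← zero_smul ℂ (muVec F N 0)]
      exact (inFreudenthalCone_muVec 0).smul 0
    · have := Set.mem_image_of_mem (Projectivization.map e.toLinearMap e.injective) (hWs v hv0 hv)
      rw [he, Projectivization.map_mk, mk_mem_varietyXf_iff] at this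
      exact this

end NotScroll

/-! ### Irreducibility and dimension of the variety -/

section Dimension

open MvPolynomial TopologicalSpace Order

variable {n : ℕ} {F G : Fin n → MvPolynomial (Fin n) ℂ} {M N : MvPolynomial (Fin n) ℂ}

/-- If two closed sets cover the image, an equation of one times an equation of the other pulls back
to zero in the domain `ℂ[x]`. The map `g` allows `Y` to be the ambient space or the variety itself.
-/
theorem isIrreducible_range_of_polynomial {Y σ : Type} {m : ℕ} [TopologicalSpace Y]
    {g : Y → ProjSpace σ} (hg : Topology.IsInducing g) (f : (Fin m → ℂ) → Y)
    (u : σ → MvPolynomial (Fin m) ℂ) (hu : ∀ x, (fun i => eval x (u i)) ≠ 0)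
    (hf : ∀ x, g (f x) = Projectivization.mk ℂ _ (hu x)) : IsIrreducible (Set.range f) := by
  refine ⟨Set.range_nonempty f, isPreirreducible_iff_isClosed_union_isClosed.2 ?_⟩
  intro Z₁ Z₂ h₁ h₂ hsub
  obtain ⟨_, hc₁, rfl⟩ := hg.isClosed_iff.1 h₁
  obtain ⟨_, hc₂, rfl⟩ := hg.isClosed_iff.1 h₂
  obtain ⟨S, hS, rfl⟩ := isClosed_iff_isProjAlgebraicSet.1 hc₁
  obtain ⟨T, hT, rfl⟩ := isClosed_iff_isProjAlgebraicSet.1 hc₂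
  have hev : ∀ (P : MvPolynomial σ ℂ) (d : ℕ), P.IsHomogeneous d → ∀ x,
      (VanishesAt P (g (f x)) ↔ eval x (bind₁ u P) = 0) := by
    intro P d hP x
    rw [hf, vanishesAt_mk hP, eval_bind₁_eq]
  by_contra! hcon
  obtain ⟨⟨_, ⟨x, rfl⟩, hx⟩, _, ⟨y, rfl⟩, hy⟩ := hcon.imp Set.not_subset.1 Set.not_subset.1
  simp only [Set.mem_preimage, Set.mem_ofPred_eq, not_forall] at hx hy
  obtain ⟨P, hP, hPx⟩ := hx
  obtain ⟨Q, hQ, hQy⟩ := hy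
  obtain ⟨d, hPd⟩ := hS P hP
  obtain ⟨e, hQe⟩ := hT Q hQ
  rw [hev P d hPd] at hPx
  rw [hev Q e hQe] at hQy
  have h0 : bind₁ u P * bind₁ u Q = 0 := by
    refine MvPolynomial.funext fun z => ?_
    rw [map_mul, map_zero]
    rcases hsub ⟨z, rfl⟩ with h | h
    · rw [(hev P d hPd z).1 (h P hP), zero_mul]
    · rw [(hev Q e hQe z).1 (h Q hQ), mul_zero]
  rcases mul_eq_zero.1 h0 with h | h
  · exact hPx (by rw [h, map_zero])
  · exact hQy (by rw [h, map_zero])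

theorem eval_muPoly (x : Fin n → ℂ) :
    (fun i => eval x (muPoly F N i)) = muVec F N x := by
  ext (_ | _ | _ | _) <;> simp [muPoly, muVec, polyMap]

theorem isIrreducible_varietyXf : IsIrreducible (varietyXf F N) := by
  refine (isIrreducible_range_of_polynomial Topology.IsInducing.id (muMap F N) (muPoly F N)
    (fun x => ?_) fun x => ?_).closure
  · rw [eval_muPoly]
    exact muVec_ne_zero F N x
  · simp only [id, eval_muPoly, muMap]

/-- The cone is parametrized by `(t, x) ↦ t (1, x, F(x), N(x))`, with `t` the variable `none`. -/
theorem topologicalKrullDim_varietyXf_le : topologicalKrullDim (varietyXf F N) ≤ n := by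
  refine topologicalKrullDim_le_of_ker_le_coneIdeal (τ := Option (Fin n))
    (bind₁ fun i => X none * rename some (muPoly F N i)) isClosed_closure
    isIrreducible_varietyXf.1 ?_ (by simp)
  intro P hP v hv hvX
  rw [RingHom.mem_ker] at hP
  replace hvX := (mk_mem_varietyXf_iff (F := F) (N := N) hv).1 hvX
  rw [← sum_homogeneousComponent P, map_sum]
  refine Finset.sum_eq_zero fun d _ =>
    hvX _ d (homogeneousComponent_isHomogeneous d P) fun x => ?_
  refine eval_homogeneousComponent_eq_zero (fun c _ => ?_) d
  have := congrArg (eval fun j : Option (Fin n) => j.elim c x) hP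
  erw [eval_bind₁_eq] at this
  rw [map_zero] at this
  rw [← this, ← eval_muPoly]
  congr 2
  ext i
  simp only [Pi.smul_apply, smul_eq_mul, map_mul, eval_X, eval_rename, Option.elim_none]
  rfl

/-- The projection of `ℂⁿ` onto the span of the first `k` basis vectors. -/
def truncate (k : ℕ) (x : Fin n → ℂ) : Fin n → ℂ := fun i => if (i : ℕ) < k then x i else 0

/-- The closures of the images of the coordinate subspaces of dimensions `0, …, n` form a chain; the
inclusion from `k` to `k + 1` is strict because the coordinate `x k` vanishes on the smaller set
only. -/
theorem le_topologicalKrullDim_varietyXf : (n : WithBot ℕ∞) ≤ topologicalKrullDim (varietyXf F N) := by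
  let ν : ℕ → (Fin n → ℂ) → varietyXf F N := fun k x =>
    ⟨muMap F N (truncate k x), subset_closure ⟨_, rfl⟩⟩
  have hirr : ∀ k, IsIrreducible (Set.range (ν k)) := by
    intro k
    let u : FreudenthalIndex n → MvPolynomial (Fin n) ℂ := fun j =>
      bind₁ (fun i : Fin n => if (i : ℕ) < k then X i else 0) (muPoly F N j)
    have hu : ∀ x, (fun j => eval x (u j)) = muVec F N (truncate k x) := by
      intro x
      rw [← eval_muPoly]
      ext j
      simp only [u, eval_bind₁_eq]
      congr 2
      ext i
      by_cases hi : (i : ℕ) < k <;> simp [truncate, hi]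
    refine isIrreducible_range_of_polynomial Topology.IsInducing.subtypeVal (ν k) u
      (fun x => ?_) fun x => ?_
    · rw [hu]
      exact muVec_ne_zero F N _
    · simp only [hu]
      rfl
  let Z : Fin (n + 1) → IrreducibleCloseds (varietyXf F N) := fun k =>
    ⟨closure (Set.range (ν k)), (hirr k).closure, isClosed_closure⟩
  have hZ : StrictMono Z := by
    rw [Fin.strictMono_iff_lt_succ]
    intro k
    rw [lt_iff_le_not_ge]
    constructor
    · refine closure_mono ?_
      rintro _ ⟨x, rfl⟩
      refine ⟨truncate k x, Subtype.ext (congrArg (muMap F N) ?_)⟩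
      ext i
      simp only [truncate, Fin.val_succ, Fin.val_castSucc]
      split_ifs <;> first | rfl | omega
    · intro hle
      have hcl : IsClosed {p : varietyXf F N |
          VanishesAt (X (.inr (.inl k)) : MvPolynomial (FreudenthalIndex n) ℂ) p} :=
        (isClosed_setOf_vanishesAt (isHomogeneous_X ℂ _)).preimage continuous_subtype_val
      have h1 : (Z k.castSucc : Set (varietyXf F N)) ⊆ {p | VanishesAt
          (X (.inr (.inl k)) : MvPolynomial (FreudenthalIndex n) ℂ) p} := by
        refine closure_minimal ?_ hcl
        rintro _ ⟨x, rfl⟩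
        change VanishesAt _ (muMap F N _)
        rw [muMap, vanishesAt_mk (isHomogeneous_X ℂ _), eval_X]
        change truncate _ x k = 0
        simp [truncate]
      have h2 : ν (k.succ : Fin (n + 1)) (fun _ => 1) ∈ (Z k.succ : Set (varietyXf F N)) :=
        subset_closure ⟨_, rfl⟩
      have h3 := h1 (hle h2)
      change VanishesAt _ (muMap F N _) at h3
      rw [muMap, vanishesAt_mk (isHomogeneous_X ℂ _), eval_X] at h3
      change truncate ((k.succ : Fin (n + 1)) : ℕ) (fun _ => (1 : ℂ)) k = 0 at h3
      simp [truncate] at h3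
  exact LTSeries.length_le_krullDim (LTSeries.mk n Z hZ)

end Dimension

/-! ### Non-degeneracy -/

section Nondegenerate

open MvPolynomial

variable {n : ℕ} {F G : Fin n → MvPolynomial (Fin n) ℂ} {N : MvPolynomial (Fin n) ℂ}

theorem linearMap_eq_zero_of_muVec (h : IsQuadroQuadricPair F G)
    (hN : IsAssociatedCubicForm F G N) (f : (FreudenthalIndex n → ℂ) →ₗ[ℂ] ℂ)
    (hf : ∀ x, f (muVec F N x) = 0) : f = 0 := by
  classical
  have hsplit : ∀ r x y s, f (freudenthalVec r x y s) = r * f (freudenthalVec 1 0 0 0) +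
      f (freudenthalVec 0 x 0 0) + f (freudenthalVec 0 0 y 0) + s * f (freudenthalVec 0 0 0 1) := by
    intro r x y s
    rw [← smul_eq_mul, ← smul_eq_mul, ← map_smul, ← map_smul, ← map_add, ← map_add, ← map_add,
      smul_freudenthalVec, smul_freudenthalVec]
    simp [freudenthalVec_add]
  have hx : ∀ (t : ℂ) x, f (freudenthalVec 0 (t • x) 0 0) = t * f (freudenthalVec 0 x 0 0) := by
    intro t x
    rw [← smul_eq_mul, ← map_smul, smul_freudenthalVec]
    simp
  have hy : ∀ (t : ℂ) y, f (freudenthalVec 0 0 (t • y) 0) = t * f (freudenthalVec 0 0 y 0) := by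
    intro t y
    rw [← smul_eq_mul, ← map_smul, smul_freudenthalVec]
    simp
  have hpoly : ∀ x (t : ℂ), f (freudenthalVec 1 0 0 0) + t * f (freudenthalVec 0 x 0 0) +
      t ^ 2 * f (freudenthalVec 0 0 (polyMap F x) 0) +
      t ^ 3 * (eval x N * f (freudenthalVec 0 0 0 1)) = 0 := by
    intro x t
    have := hf (t • x)
    rw [muVec_eq_freudenthalVec, hsplit, polyMap_smul h.lift.homogeneous, hN.homogeneous.eval_smul,
      hx, hy] at this
    linear_combination this
  have h1 : f (freudenthalVec 1 0 0 0) = 0 := by simpa using hpoly 0 0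
  -- The values `t = 1, -1, 2` separate the coefficients of the cubic polynomial in `t`.
  have h2 : ∀ x, f (freudenthalVec 0 0 (polyMap F x) 0) = 0 := fun x => by
    linear_combination (hpoly x 1 + hpoly x (-1)) / 2 - h1
  have h3 : ∀ x, eval x N * f (freudenthalVec 0 0 0 1) = 0 := fun x => by
    linear_combination (hpoly x 2 - 2 * hpoly x 1 + h1 - 2 * h2 x) / 6
  have h4 : ∀ x, f (freudenthalVec 0 x 0 0) = 0 := fun x => by
    linear_combination hpoly x 1 - h1 - h2 x - h3 x
  have h5 : f (freudenthalVec 0 0 0 1) = 0 := by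
    obtain ⟨a, ha⟩ : ∃ a, eval a N ≠ 0 := by
      by_contra! h0
      exact hN.ne_zero h (MvPolynomial.funext fun x => by rw [h0, map_zero])
    exact (mul_eq_zero.1 (h3 a)).resolve_left ha
  have h6 : ∀ y, f (freudenthalVec 0 0 y 0) = 0 := by
    obtain ⟨M, hM⟩ := h.symm.exists_cubicForm
    let ι : (Fin n → ℂ) →ₗ[ℂ] ℂ :=
      { toFun := fun y => f (freudenthalVec 0 0 y 0)
        map_add' := fun y z => by rw [← map_add, freudenthalVec_add]; simp
        map_smul' := fun c y => hy c y }
    have hι : ∀ y, ι y = eval y (∑ i, C (ι (Pi.single i 1)) * X i) := by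
      intro y
      have hs : ∀ i : Fin n, (fun k => if i = k then (1 : ℂ) else 0) = Pi.single i 1 := by
        intro i
        ext k
        simp [Pi.single_apply, eq_comm]
      rw [LinearMap.pi_apply_eq_sum_univ ι y]
      simp [hs, mul_comm]
    -- The form `ι` vanishes on the values of `F`, among them `F(G(y)) = M(y) y`; hence `M * ι = 0`,
    -- where `M ≠ 0`.
    have h0 : M * ∑ i, C (ι (Pi.single i 1)) * X i = 0 := by
      refine MvPolynomial.funext fun y => ?_
      have := h2 (polyMap G y)
      rw [hM.eq_smul, hy] at this
      rw [map_mul, ← hι, map_zero]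
      exact this
    intro y
    change ι y = 0
    rw [hι, (mul_eq_zero.1 h0).resolve_left (hM.ne_zero h.symm), map_zero]
  refine LinearMap.ext fun v => ?_
  obtain ⟨r, x, y, s, rfl⟩ := exists_eq_freudenthalVec v
  rw [hsplit, h1, h4, h5, h6]
  simp

theorem span_varietyXf (h : IsQuadroQuadricPair F G) (hN : IsAssociatedCubicForm F G N) :
    Projectivization.Subspace.span (varietyXf F N) = ⊤ := by
  refine Projectivization.Subspace.submodule.injective ?_
  rw [map_top]
  by_contra hne
  obtain ⟨f, hf0, hf⟩ := Submodule.exists_le_ker_of_lt_top _ (lt_top_iff_ne_top.2 hne)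
  refine hf0 (linearMap_eq_zero_of_muVec h hN f fun x => hf ?_)
  rw [Projectivization.Subspace.mem_submodule_iff _ (muVec_ne_zero F N x)]
  exact Projectivization.Subspace.subset_span _ (subset_closure ⟨x, rfl⟩)

end Nondegenerate

theorem proposition3p2 (n : ℕ) (F G : Fin n → MvPolynomial (Fin n) ℂ)
    (hFG : IsQuadroQuadricPair F G) :
    (∃! N : MvPolynomial (Fin n) ℂ, IsAssociatedCubicForm F G N) ∧
      ∀ N : MvPolynomial (Fin n) ℂ, IsAssociatedCubicForm F G N →
        IsExtremalX33 n (varietyXf F N) := by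
  refine ⟨?_, fun N hN => ?_⟩
  · obtain ⟨N, hN⟩ := hFG.exists_cubicForm
    have hn := hFG.lift.two_le
    exact ⟨N, hN, fun M hM => hN.unique (by omega) hM⟩
  · exact
      { ambient := by
          simp only [Fintype.card_sum, Fintype.card_unit, Fintype.card_fin]
          omega
        closed := isClosed_closure
        irreducible := isIrreducible_varietyXf
        dimension := le_antisymm topologicalKrullDim_varietyXf_le le_topologicalKrullDim_varietyXf
        nondegenerate := span_varietyXf hFG hN
        threeRC := isThreeRC_varietyXf hFG hN
        not_scroll := not_isRationalNormalScroll_varietyXf hFG hN }
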